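/- All graphs are finite and simple. A graph is \emph{chordal} if it has no induced cycle of length at least four. A \emph{circular-arc model} of a graph assigns to each vertex a closed arc of a circle (single points are allowed) such that two distinct vertices are adjacent if and only if their arcs intersect; it is \emph{Helly} if every set of pairwise intersecting arcs of the model has a common point. A graph is a \emph{(Helly) circular-arc graph} if it has a (Helly) circular-arc model. For $k\ge 1$, the gadget $D_k$ is the graph with vertices $v_1,\dots,v_k$ (a clique, the \emph{clique vertices}) and $w_0,\dots,w_k$ (an independent set), in which $w_j$ is adjacent to exactly the clique vertices other than $v_j$ and $v_{j+1}$ (where $v_0$, $v_{k+1}$ do not exist). Its left and right ends are $w_0$ and $w_k$. Let $p\ge 1$ and let $a_0,\dots,a_{2p-1}$ be positive integers. The graph $\otimes(a_0,\dots,a_{2p-1})$ is obtained as follows. For $i=0,\dots,p-1$, take a gadget $D_{a_{2i}}$, with clique vertices $v^{2i}_1,\dots,v^{2i}_{a_{2i}}$ and other vertices $w^{2i}_0,\dots,w^{2i}_{a_{2i}}$, and a path $v^{2i+1}_1v^{2i+1}_2\cdots v^{2i+1}_{a_{2i+1}}$ with left end $v^{2i+1}_1$ and right end $v^{2i+1}_{a_{2i+1}}$.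 Arrange them in the circular order $D_{a_0},P_{a_1},D_{a_2},\dots,P_{a_{2p-1}}$ and join the right end of each gadget or path to the left end of the next path or gadget. Add a vertex $c$, and join every clique vertex of each gadget to all vertices outside this gadget (including $c$). Let $G=\otimes(a_0,\dots,a_{2p-1})$, where $p\ge1$ and $(a_0,\dots,a_{2p-1})$ is a sequence of positive integers different from $(1,1)$ and $(1,2)$. Then: 1. $G$ is a chordal graph; 2. $G$ is not a circular-arc graph; 3. for every vertex $x$ of $G$, the graph $G-x$ is a Helly circular-arc graph. Moreover, an explicit Helly circular-arc model of $G-x$ on a circle of length $4\ell$, $\ell=\sum_{i=0}^{2p-1}a_i$, is the following. Put $v_{a_0+\cdots+a_{i-1}+j}=v^i_j$ for $0\le i\le 2p-1$ and $1\le j\le a_i$, and $w_{a_0+\cdots+a_{i-1}+j}=w^i_j$ for even $i$ and $0\le j\le a_i$; let $v_0=v_\ell$. Write $[l,r]$ for the closed arc from coordinate $l$ clockwise to coordinate $r$, with coordinates modulo $4\ell$, where $[l,l]$ is a single point. Unless modified below, the arcs are $A(w_s)=[4s+2,4s+2]$, $A(v_s)=[4s-3,4s+3]$ if $v_s\notin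 N_G(c)$, and $A(v_s)=[4s+3,4s-3]$ if $v_s\in N_G(c)$. - If $x=c$, there is no modification. - If $x=v_s$ with $1\le s\le\ell$, then $A(c)=[4s,4s]$. - If $x=w_s$ and $v_s,v_{s+1}\in N_G(c)$, then $A(v_s)=[4s+1,4s-3]$, $A(v_{s+1})=[4s+7,4s+3]$, $A(c)=[4s+2,4s+2]$. - If $x=w_s$, $v_s\in N_G(c)$ and $v_{s+1}\notin N_G(c)$, then $A(v_s)=[4s,4s-3]$, $A(c)=[4s,4s]$. - If $x=w_s$, $v_s\notin N_G(c)$ and $v_{s+1}\in N_G(c)$, then $A(v_{s+1})=[4s+7,4s+4]$, $A(c)=[4s+4,4s+4]$. -/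

import Mathlib

/-- A graph is chordal if it has no induced cycle of length at least four. -/
def IsChordalGraph {V : Type*} (G : SimpleGraph V) : Prop :=
  ∀ n : ℕ, 4 ≤ n → IsEmpty (SimpleGraph.cycleGraph n ↪g G)

/-- The closed arc of a circle of length `T` that is traversed when walking clockwise from the
point with coordinate `l` to the point with coordinate `r`, where `l ≤ r ≤ l + T`
(a single point if `l = r`, the whole circle if `r = l + T`). -/
def circleArc (T l r : ℝ) : Set (AddCircle T) :=
  (fun t : ℝ => (t : AddCircle T)) '' Set.Icc l r

/-- A closed arc of a circle of length `T`. -/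
def IsCircleArc (T : ℝ) (S : Set (AddCircle T)) : Prop :=
  ∃ l r : ℝ, l ≤ r ∧ r ≤ l + T ∧ S = circleArc T l r

/-- The family `A` of arcs on a circle of length `T` is a circular-arc model of `G`: two distinct
vertices are adjacent if and only if their arcs intersect. -/
def IsCircularArcModel {V : Type*} (G : SimpleGraph V) (T : ℝ) (A : V → Set (AddCircle T)) :
    Prop :=
  (∀ v, IsCircleArc T (A v)) ∧ ∀ u v, u ≠ v → (G.Adj u v ↔ (A u ∩ A v).Nonempty)

/-- A circular-arc model that is Helly: every set of pairwise intersecting arcs (equivalently,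
the arcs of every clique) has a common point. -/
def IsHellyCircularArcModel {V : Type*} (G : SimpleGraph V) (T : ℝ)
    (A : V → Set (AddCircle T)) : Prop :=
  IsCircularArcModel G T A ∧
    ∀ K : Set V, (∀ u ∈ K, ∀ v ∈ K, (A u ∩ A v).Nonempty) → (⋂ v ∈ K, A v).Nonempty

/-- Circular-arc graphs: graphs with a circular-arc model on some circle. -/
def IsCircularArcGraph {V : Type*} (G : SimpleGraph V) : Prop :=
  ∃ T : ℝ, 0 < T ∧ ∃ A : V → Set (AddCircle T), IsCircularArcModel G T A

/-- Helly circular-arc graphs: graphs with a Helly circular-arc model on some circle. -/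
def IsHellyCircularArcGraph {V : Type*} (G : SimpleGraph V) : Prop :=
  ∃ T : ℝ, 0 < T ∧ ∃ A : V → Set (AddCircle T), IsHellyCircularArcModel G T A

/-- The position `2 i` in the sequence `a₀, …, a_{2p-1}`. -/
def evenIdx {p : ℕ} (i : Fin p) : Fin (2 * p) := ⟨2 * i.val, by omega⟩

/-- The position `2 i + 1` in the sequence `a₀, …, a_{2p-1}`. -/
def oddIdx {p : ℕ} (i : Fin p) : Fin (2 * p) := ⟨2 * i.val + 1, by omega⟩

/-- The vertices of `⊗(a₀, …, a_{2p-1})`. In the `i`-th gadget, which is `D_k` with `k = a_{2i}`,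
`clique i j` is the clique vertex `v_{j+1}` (`0 ≤ j < k`) and `leaf i j` is the independent
vertex `w_j` (`0 ≤ j ≤ k`). The vertex `path i j` is the `(j+1)`-st vertex of the `i`-th path,
which has `a_{2i+1}` vertices. -/
inductive OtimesVertex {p : ℕ} (a : Fin (2 * p) → ℕ) : Type
  | c : OtimesVertex a
  | clique (i : Fin p) (j : Fin (a (evenIdx i))) : OtimesVertex a
  | leaf (i : Fin p) (j : Fin (a (evenIdx i) + 1)) : OtimesVertex a
  | path (i : Fin p) (j : Fin (a (oddIdx i))) : OtimesVertex a

/-- The edges of `⊗(a₀, …, a_{2p-1})`, each listed in at least one direction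
(loops are discarded in `otimesGraph`). -/
def otimesRel {p : ℕ} (a : Fin (2 * p) → ℕ) : OtimesVertex a → OtimesVertex a → Prop
  -- the clique vertices of all gadgets form a clique
  | .clique _ _, .clique _ _ => True
  -- a clique vertex is adjacent to everything outside its gadget
  | .clique _ _, .c => True
  | .clique _ _, .path _ _ => True
  -- inside a gadget, `w_j` is adjacent to all clique vertices except `v_j` and `v_{j+1}`
  | .clique i m, .leaf i' j => i ≠ i' ∨ (m.val + 1 ≠ j.val ∧ m.val ≠ j.val)
  -- right end of a gadget with left end of the next path;
  -- right end of a path with left end of the (cyclically) next gadget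
  | .leaf i j, .path i' m =>
      (i = i' ∧ j.val = a (evenIdx i) ∧ m.val = 0) ∨
      (i.val = (i'.val + 1) % p ∧ j.val = 0 ∧ m.val + 1 = a (oddIdx i'))
  -- consecutive vertices of a path
  | .path i m, .path i' m' => i = i' ∧ m.val + 1 = m'.val
  | _, _ => False

/-- The graph `⊗(a₀, …, a_{2p-1})`. -/
def otimesGraph {p : ℕ} (a : Fin (2 * p) → ℕ) : SimpleGraph (OtimesVertex a) :=
  SimpleGraph.fromRel (otimesRel a)

/-- `ℓ = a₀ + ⋯ + a_{2p-1}`. -/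
def otimesLength {p : ℕ} (a : Fin (2 * p) → ℕ) : ℕ := ∑ k, a k

/-- The index `s` in the consecutive numbering `v_1, …, v_ℓ` of the clique and path vertices and
in the induced numbering `w_s` of the leaves: the clique or path vertex number `j + 1` of block
`i` gets the index `a_0 + ⋯ + a_{i-1} + j + 1`, the leaf number `j` of block `i` the index
`a_0 + ⋯ + a_{i-1} + j`. (The value at `c` is never used for a vertex of `G - c`.) -/
def otimesIndex {p : ℕ} (a : Fin (2 * p) → ℕ) : OtimesVertex a → ℕ
  | .c => 0
  | .clique i j => (∑ k ∈ Finset.Iio (evenIdx i), a k) + j.val + 1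
  | .leaf i j => (∑ k ∈ Finset.Iio (evenIdx i), a k) + j.val
  | .path i j => (∑ k ∈ Finset.Iio (oddIdx i), a k) + j.val + 1

/-- The coordinate of the one-point arc of `c` in the model of `G - x`. -/
def otimesCenter {p : ℕ} (a : Fin (2 * p) → ℕ) (x : OtimesVertex a) : ℝ :=
  match x with
  | .leaf i j =>
      if j.val = 0 then 4 * otimesIndex a x + 4
      else if j.val = a (evenIdx i) then 4 * otimesIndex a x
      else 4 * otimesIndex a x + 2
  | _ => 4 * otimesIndex a x

/-- The explicit arc of the vertex `u` in the model of `G - x`, on a circle of length `4ℓ`. -/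
def otimesArc {p : ℕ} (a : Fin (2 * p) → ℕ) (x u : OtimesVertex a) :
    Set (AddCircle (4 * (otimesLength a : ℝ))) :=
  let L : ℝ := 4 * (otimesLength a : ℝ)
  let s : ℝ := otimesIndex a u
  match u, x with
  | .c, x => circleArc L (otimesCenter a x) (otimesCenter a x)
  | .leaf _ _, _ => circleArc L (4 * s + 2) (4 * s + 2)
  | .path _ _, _ => circleArc L (4 * s - 3) (4 * s + 3)
  | .clique i m, .leaf i' j =>
      -- only the at most two clique vertices `v_j`, `v_{j+1}` in the gadget of `w_j`
      -- have an arc that differs from the standard one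
      if i = i' ∧ m.val + 1 = j.val then
        circleArc L (if j.val = a (evenIdx i') then 4 * s else 4 * s + 1) (4 * s - 3 + L)
      else if i = i' ∧ m.val = j.val then
        circleArc L (4 * s + 3) (if j.val = 0 then 4 * s + L else 4 * s - 1 + L)
      else circleArc L (4 * s + 3) (4 * s - 3 + L)
  | .clique _ _, _ => circleArc L (4 * s + 3) (4 * s - 3 + L)

/-! Chordality: eliminate `c` and the leaves, then the path vertices in increasing index, then the
clique vertices. When a vertex is removed, its remaining neighbours form a clique.

The models of `G - x`: all end points are integers affine in the consecutive numbering
`otimesIndex`, and adjacency is also arithmetic in that numbering (`adj_clique_leaf`,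
`adj_leaf_path`, `adj_path_path`). Hence `adj_iff_meets` reduces to linear integer arithmetic. For
the Helly property, a clique containing `c` or a leaf is pinned by a one-point arc. Any other clique
has at most two path vertices besides clique vertices, and a common point is written down.

No model of `G`: cutting a circle at the arc of `c` turns the non-neighbours of `c` into real
intervals (`IsCircularArcGraph.exists_intervals`). Leaves and path vertices form a cyclic sequence
of length `ℓ + p`, whose consecutive members are adjacent or are exactly the two missed by a
neighbour of `c`. No third interval of the sequence can then separate two consecutive ones, so every
interval lies left of all its non-neighbours in the sequence or right of all of them. Non-adjacency
on the sequence would therefore be bipartite (`IsCircularArcGraph.exists_bipartition`), but it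
contains a 5-cycle, or a triangle for `(2, 1)`. The excluded sequences `(1, 1)` and `(1, 2)` are
those where no odd cycle arises. -/

namespace Otimes

/-! ### Arithmetic of the consecutive numbering. -/

variable {p : ℕ} {a : Fin (2 * p) → ℕ}

/-- The sum of the first `k` terms of the sequence `a`. -/
def prefixSum (a : Fin (2 * p) → ℕ) (k : ℕ) : ℕ :=
  ∑ i ∈ Finset.range k, if h : i < 2 * p then a ⟨i, h⟩ else 0

theorem prefixSum_zero : prefixSum a 0 = 0 := by simp [prefixSum]

theorem prefixSum_mono {k m : ℕ} (h : k ≤ m) : prefixSum a k ≤ prefixSum a m :=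
  Finset.sum_le_sum_of_subset (by simpa using h)

theorem prefixSum_even (i : Fin p) :
    prefixSum a (2 * i + 1) = prefixSum a (2 * i) + a (evenIdx i) := by
  have h : 2 * i.val < 2 * p := by omega
  simp [prefixSum, Finset.sum_range_succ, evenIdx, h]

theorem prefixSum_odd (i : Fin p) :
    prefixSum a (2 * i + 2) = prefixSum a (2 * i + 1) + a (oddIdx i) := by
  have h : 2 * i.val + 1 < 2 * p := by omega
  rw [prefixSum, Finset.sum_range_succ, dif_pos h]
  rfl

theorem prefixSum_length : prefixSum a (2 * p) = otimesLength a := by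
  rw [prefixSum, Finset.sum_range, otimesLength]
  exact Finset.sum_congr rfl fun i _ => dif_pos i.isLt

theorem sum_Iio (k : Fin (2 * p)) : ∑ i ∈ Finset.Iio k, a i = prefixSum a k := by
  rw [prefixSum]
  refine Finset.sum_bij (fun i _ => i.val) ?_ ?_ ?_ ?_
  · intro i hi
    simpa using hi
  · intro i _ j _ h
    exact Fin.ext h
  · intro j hj
    have hj' : j < k.val := by simpa using hj
    exact ⟨⟨j, by omega⟩, by simpa [Fin.lt_def] using hj', rfl⟩
  · intro i _
    simp

theorem index_clique (i : Fin p) (j : Fin (a (evenIdx i))) :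
    otimesIndex a (.clique i j) = prefixSum a (2 * i) + j + 1 := by
  simp only [otimesIndex, sum_Iio]; rfl

theorem index_leaf (i : Fin p) (j : Fin (a (evenIdx i) + 1)) :
    otimesIndex a (.leaf i j) = prefixSum a (2 * i) + j := by
  simp only [otimesIndex, sum_Iio]; rfl

theorem index_path (i : Fin p) (j : Fin (a (oddIdx i))) :
    otimesIndex a (.path i j) = prefixSum a (2 * i + 1) + j + 1 := by
  simp only [otimesIndex, sum_Iio]; rfl

/-- Distinct pairs of blocks occupy consecutive disjoint ranges. -/
theorem prefixSum_trichotomy (i i' : Fin p) :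
    i = i' ∨ (i.val < i'.val ∧ prefixSum a (2 * i + 2) ≤ prefixSum a (2 * i')) ∨
      (i'.val < i.val ∧ prefixSum a (2 * i' + 2) ≤ prefixSum a (2 * i)) := by
  rcases lt_trichotomy i.val i'.val with h | h | h
  · exact Or.inr (Or.inl ⟨h, prefixSum_mono (by omega)⟩)
  · exact Or.inl (Fin.ext h)
  · exact Or.inr (Or.inr ⟨h, prefixSum_mono (by omega)⟩)

theorem prefixSum_block_le (i : Fin p) : prefixSum a (2 * i + 2) ≤ otimesLength a := by
  rw [← prefixSum_length]
  exact prefixSum_mono (by omega)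

theorem prefixSum_lt (ha : ∀ i, 0 < a i) {k m : ℕ} (h : k < m) (hm : m ≤ 2 * p) :
    prefixSum a k < prefixSum a m := by
  refine lt_of_lt_of_le ?_ (prefixSum_mono (Nat.succ_le_of_lt h))
  have hk : k < 2 * p := by omega
  rw [prefixSum, prefixSum, Finset.sum_range_succ, dif_pos hk]
  exact Nat.lt_add_of_pos_right (ha _)

/-- Prefix sums of positive terms are strictly increasing, so they determine the block. The second
alternative is the wrap-around from the last path to the first gadget. -/
theorem next_block_iff (ha : ∀ i, 0 < a i) (i i' : Fin p) :
    i.val = (i'.val + 1) % p ↔ prefixSum a (2 * i) = prefixSum a (2 * i' + 2) ∨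
      (prefixSum a (2 * i) = 0 ∧ prefixSum a (2 * i' + 2) = otimesLength a) := by
  have inj {k m : ℕ} (hk : k ≤ 2 * p) (hm : m ≤ 2 * p) (h : prefixSum a k = prefixSum a m) :
      k = m := by
    rcases lt_trichotomy k m with h' | h' | h'
    · exact absurd h (prefixSum_lt ha h' hm).ne
    · exact h'
    · exact absurd h (prefixSum_lt ha h' hk).ne'
  have h0 : prefixSum a (2 * i) = 0 ↔ i.val = 0 := by
    refine ⟨fun h => ?_, fun h => by rw [h]; exact prefixSum_zero⟩
    have := inj (m := 0) (by omega) (by omega) (h.trans prefixSum_zero.symm)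
    omega
  have hl : prefixSum a (2 * i' + 2) = otimesLength a ↔ i'.val + 1 = p := by
    rw [← prefixSum_length]
    refine ⟨fun h => ?_, fun h => congrArg (prefixSum a) (by omega)⟩
    have := inj (by omega) (by omega) h
    omega
  have he : prefixSum a (2 * i) = prefixSum a (2 * i' + 2) ↔ i.val = i'.val + 1 := by
    refine ⟨fun h => ?_, fun h => by rw [h]; rfl⟩
    have := inj (by omega) (by omega) h
    omega
  rw [h0, hl, he]
  rcases Nat.lt_or_ge (i'.val + 1) p with h | h
  · rw [Nat.mod_eq_of_lt h]
    omega
  · rw [show i'.val + 1 = p by omega, Nat.mod_self]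
    omega

theorem clique_range (ha : ∀ i, 0 < a i) (i : Fin p) (j : Fin (a (evenIdx i))) :
    1 ≤ otimesIndex a (.clique i j) ∧ otimesIndex a (.clique i j) < otimesLength a := by
  have h1 := prefixSum_even (a := a) i
  have h2 := prefixSum_odd (a := a) i
  have h3 := prefixSum_block_le (a := a) i
  have := ha (oddIdx i)
  rw [index_clique]
  omega

theorem leaf_range (ha : ∀ i, 0 < a i) (i : Fin p) (j : Fin (a (evenIdx i) + 1)) :
    otimesIndex a (.leaf i j) < otimesLength a := by
  have h1 := prefixSum_even (a := a) i
  have h2 := prefixSum_odd (a := a) i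
  have h3 := prefixSum_block_le (a := a) i
  have := ha (oddIdx i)
  rw [index_leaf]
  omega

theorem path_range (ha : ∀ i, 0 < a i) (i : Fin p) (j : Fin (a (oddIdx i))) :
    2 ≤ otimesIndex a (.path i j) ∧ otimesIndex a (.path i j) ≤ otimesLength a := by
  have h1 := prefixSum_even (a := a) i
  have h2 := prefixSum_odd (a := a) i
  have h3 := prefixSum_block_le (a := a) i
  have := ha (evenIdx i)
  rw [index_path]
  omega

theorem clique_index_inj {i i' : Fin p} {j : Fin (a (evenIdx i))} {j' : Fin (a (evenIdx i'))}
    (h : otimesIndex a (.clique i j) = otimesIndex a (.clique i' j')) :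
    OtimesVertex.clique i j = .clique i' j' := by
  have h1 := prefixSum_even (a := a) i
  have h2 := prefixSum_odd (a := a) i
  have h1' := prefixSum_even (a := a) i'
  have h2' := prefixSum_odd (a := a) i'
  rw [index_clique, index_clique] at h
  rcases prefixSum_trichotomy (a := a) i i' with rfl | h' | h'
  · rw [show j = j' from Fin.ext (by omega)]
  · omega
  · omega

theorem leaf_index_inj (ha : ∀ i, 0 < a i) {i i' : Fin p} {j : Fin (a (evenIdx i) + 1)}
    {j' : Fin (a (evenIdx i') + 1)}
    (h : otimesIndex a (.leaf i j) = otimesIndex a (.leaf i' j')) :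
    OtimesVertex.leaf i j = .leaf i' j' := by
  have h1 := prefixSum_even (a := a) i
  have h2 := prefixSum_odd (a := a) i
  have h1' := prefixSum_even (a := a) i'
  have h2' := prefixSum_odd (a := a) i'
  have := ha (oddIdx i)
  have := ha (oddIdx i')
  rw [index_leaf, index_leaf] at h
  rcases prefixSum_trichotomy (a := a) i i' with rfl | h' | h'
  · rw [show j = j' from Fin.ext (by omega)]
  · omega
  · omega

theorem path_index_inj {i i' : Fin p} {j : Fin (a (oddIdx i))} {j' : Fin (a (oddIdx i'))}
    (h : otimesIndex a (.path i j) = otimesIndex a (.path i' j')) :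
    OtimesVertex.path i j = .path i' j' := by
  have h1 := prefixSum_even (a := a) i
  have h2 := prefixSum_odd (a := a) i
  have h1' := prefixSum_even (a := a) i'
  have h2' := prefixSum_odd (a := a) i'
  rw [index_path, index_path] at h
  rcases prefixSum_trichotomy (a := a) i i' with rfl | h' | h'
  · rw [show j = j' from Fin.ext (by omega)]
  · omega
  · omega

theorem clique_index_ne_path {i i' : Fin p} (j : Fin (a (evenIdx i))) (j' : Fin (a (oddIdx i'))) :
    otimesIndex a (.clique i j) ≠ otimesIndex a (.path i' j') := by
  have h1 := prefixSum_even (a := a) i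
  have h2 := prefixSum_odd (a := a) i
  have h1' := prefixSum_even (a := a) i'
  have h2' := prefixSum_odd (a := a) i'
  rw [index_clique, index_path]
  rcases prefixSum_trichotomy (a := a) i i' with rfl | h' | h' <;> omega

theorem succ_eq_leaf_iff (ha : ∀ i, 0 < a i) {i i' : Fin p} (m : Fin (a (evenIdx i)))
    (j : Fin (a (evenIdx i') + 1)) :
    (i = i' ∧ m.val + 1 = j.val) ↔
      otimesIndex a (.clique i m) = otimesIndex a (.leaf i' j) := by
  have h1 := prefixSum_even (a := a) i
  have h2 := prefixSum_odd (a := a) i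
  have h1' := prefixSum_even (a := a) i'
  have h2' := prefixSum_odd (a := a) i'
  have := ha (oddIdx i)
  have := ha (oddIdx i')
  rw [index_clique, index_leaf]
  rcases prefixSum_trichotomy (a := a) i i' with rfl | h' | h'
  · simp only [true_and]; omega
  · have : i ≠ i' := by rintro rfl; omega
    simp only [this, false_and, false_iff]; omega
  · have : i ≠ i' := by rintro rfl; omega
    simp only [this, false_and, false_iff]; omega

theorem eq_leaf_iff (ha : ∀ i, 0 < a i) {i i' : Fin p} (m : Fin (a (evenIdx i)))
    (j : Fin (a (evenIdx i') + 1)) :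
    (i = i' ∧ m.val = j.val) ↔
      otimesIndex a (.clique i m) = otimesIndex a (.leaf i' j) + 1 := by
  have h1 := prefixSum_even (a := a) i
  have h2 := prefixSum_odd (a := a) i
  have h1' := prefixSum_even (a := a) i'
  have h2' := prefixSum_odd (a := a) i'
  have := ha (oddIdx i)
  have := ha (oddIdx i')
  rw [index_clique, index_leaf]
  rcases prefixSum_trichotomy (a := a) i i' with rfl | h' | h'
  · simp only [true_and]; omega
  · have : i ≠ i' := by rintro rfl; omega
    simp only [this, false_and, false_iff]; omega
  · have : i ≠ i' := by rintro rfl; omega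
    simp only [this, false_and, false_iff]; omega

/-- With `clique_index_ne_path`, this and the next lemma show that no path vertex occupies an index
next to a leaf on a side facing the inside of its gadget. -/
theorem clique_of_leaf_ne_zero {i : Fin p} {j : Fin (a (evenIdx i) + 1)} (h : j.val ≠ 0) :
    ∃ m : Fin (a (evenIdx i)), otimesIndex a (.clique i m) = otimesIndex a (.leaf i j) :=
  ⟨⟨j.val - 1, by omega⟩, by rw [index_clique, index_leaf]; simp only; omega⟩

theorem clique_of_leaf_ne_last {i : Fin p} {j : Fin (a (evenIdx i) + 1)}
    (h : j.val ≠ a (evenIdx i)) :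
    ∃ m : Fin (a (evenIdx i)), otimesIndex a (.clique i m) = otimesIndex a (.leaf i j) + 1 :=
  ⟨⟨j.val, by omega⟩, by rw [index_clique, index_leaf]⟩

/-! ### Adjacency in terms of indices. -/

theorem adj_clique_clique {i i' : Fin p} {j : Fin (a (evenIdx i))} {j' : Fin (a (evenIdx i'))} :
    (otimesGraph a).Adj (.clique i j) (.clique i' j') ↔
      OtimesVertex.clique i j ≠ .clique i' j' := by
  simp [otimesGraph, otimesRel]

theorem adj_clique_c {i : Fin p} {j : Fin (a (evenIdx i))} :
    (otimesGraph a).Adj (.clique i j) .c := by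
  simp [otimesGraph, otimesRel]

theorem adj_clique_path {i i' : Fin p} {j : Fin (a (evenIdx i))} {j' : Fin (a (oddIdx i'))} :
    (otimesGraph a).Adj (.clique i j) (.path i' j') := by
  simp [otimesGraph, otimesRel]

theorem not_adj_leaf_leaf {i i' : Fin p} {j : Fin (a (evenIdx i) + 1)}
    {j' : Fin (a (evenIdx i') + 1)} : ¬ (otimesGraph a).Adj (.leaf i j) (.leaf i' j') := by
  simp [otimesGraph, otimesRel]

theorem not_adj_leaf_c {i : Fin p} {j : Fin (a (evenIdx i) + 1)} :
    ¬ (otimesGraph a).Adj (.leaf i j) .c := by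
  simp [otimesGraph, otimesRel]

theorem not_adj_path_c {i : Fin p} {j : Fin (a (oddIdx i))} :
    ¬ (otimesGraph a).Adj (.path i j) .c := by
  simp [otimesGraph, otimesRel]

theorem adj_clique_leaf (ha : ∀ i, 0 < a i) {i i' : Fin p} {m : Fin (a (evenIdx i))}
    {j : Fin (a (evenIdx i') + 1)} :
    (otimesGraph a).Adj (.clique i m) (.leaf i' j) ↔
      otimesIndex a (.clique i m) ≠ otimesIndex a (.leaf i' j) ∧
      otimesIndex a (.clique i m) ≠ otimesIndex a (.leaf i' j) + 1 := by
  rw [Ne, Ne, ← succ_eq_leaf_iff ha, ← eq_leaf_iff ha]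
  simp only [otimesGraph, SimpleGraph.fromRel_adj, otimesRel]
  simp only [ne_eq, reduceCtorEq, not_false_eq_true, or_false, true_and]
  tauto

/-- The alternatives are the preceding path, the following path, and the closing edge from index `ℓ`
to leaf `0`. Inner leaves satisfy none of them, because the indices beside them belong to clique
vertices. -/
theorem adj_leaf_path (ha : ∀ i, 0 < a i) {i i' : Fin p}
    {j : Fin (a (evenIdx i) + 1)} {m : Fin (a (oddIdx i'))} :
    (otimesGraph a).Adj (.leaf i j) (.path i' m) ↔
      otimesIndex a (.path i' m) = otimesIndex a (.leaf i j) ∨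
      otimesIndex a (.path i' m) = otimesIndex a (.leaf i j) + 1 ∨
      (otimesIndex a (.leaf i j) = 0 ∧ otimesIndex a (.path i' m) = otimesLength a) := by
  have h1 := prefixSum_even (a := a) i
  have h2 := prefixSum_odd (a := a) i
  have h1' := prefixSum_even (a := a) i'
  have h2' := prefixSum_odd (a := a) i'
  have := ha (evenIdx i)
  have := ha (evenIdx i')
  have h3 := prefixSum_block_le (a := a) i
  have h3' := prefixSum_block_le (a := a) i'
  have hm := m.isLt
  have hj := j.isLt
  simp only [otimesGraph, SimpleGraph.fromRel_adj, otimesRel, next_block_iff ha]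
  simp only [ne_eq, reduceCtorEq, not_false_eq_true, or_false, true_and]
  rw [index_leaf, index_path]
  rcases prefixSum_trichotomy (a := a) i i' with rfl | h' | h'
  · simp only [true_and]
    omega
  · have : i ≠ i' := by rintro rfl; omega
    simp only [this, false_and, false_or]
    have := ha (oddIdx i)
    omega
  · have : i ≠ i' := by rintro rfl; omega
    simp only [this, false_and, false_or]
    omega

theorem adj_path_path (ha : ∀ i, 0 < a i) {i i' : Fin p} {j : Fin (a (oddIdx i))}
    {j' : Fin (a (oddIdx i'))} :
    (otimesGraph a).Adj (.path i j) (.path i' j') ↔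
      otimesIndex a (.path i j) + 1 = otimesIndex a (.path i' j') ∨
      otimesIndex a (.path i' j') + 1 = otimesIndex a (.path i j) := by
  have h1 := prefixSum_even (a := a) i
  have h2 := prefixSum_odd (a := a) i
  have h1' := prefixSum_even (a := a) i'
  have h2' := prefixSum_odd (a := a) i'
  have := ha (evenIdx i)
  have := ha (evenIdx i')
  simp only [otimesGraph, SimpleGraph.fromRel_adj, otimesRel]
  rw [index_path, index_path]
  rcases prefixSum_trichotomy (a := a) i i' with rfl | h' | h'
  · simp only [ne_eq, OtimesVertex.path.injEq, heq_eq_eq, true_and, Fin.ext_iff]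
    omega
  · have : i ≠ i' := by rintro rfl; omega
    simp only [this, this.symm, false_and, or_false, and_false, false_iff]
    omega
  · have : i ≠ i' := by rintro rfl; omega
    simp only [this, this.symm, false_and, or_false, and_false, false_iff]
    omega

end Otimes

/-! ### Chordality. -/

/-- A graph with a perfect elimination ordering (with ties allowed) is chordal. -/
theorem isChordalGraph_of_rank {V : Type*} {G : SimpleGraph V} (r : V → ℕ)
    (h : ∀ v u w, G.Adj v u → G.Adj v w → u ≠ w → r v ≤ r u → r v ≤ r w → G.Adj u w) :
    IsChordalGraph G := by
  intro n hn
  obtain ⟨n, rfl⟩ := Nat.exists_eq_add_of_le' hn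
  refine ⟨fun f => ?_⟩
  obtain ⟨t, ht⟩ := Finite.exists_min (fun t => r (f t))
  -- On the cycle, the two neighbours of the vertex of least rank are distinct because `2 ≠ 0` and
  -- non-adjacent because `1 ≠ 0` and `3 ≠ 0`. The last fact needs length at least four.
  have two_ne_zero' : (1 : Fin (n + 4)) + 1 ≠ 0 := by
    intro h; simp [Fin.ext_iff, Fin.val_add, Nat.mod_eq_of_lt] at h
  have three_ne_zero' : (1 : Fin (n + 4)) + 1 + 1 ≠ 0 := by
    intro h; simp [Fin.ext_iff, Fin.val_add, Nat.mod_eq_of_lt] at h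
  have h1 : (SimpleGraph.cycleGraph (n + 4)).Adj t (t + 1) :=
    SimpleGraph.cycleGraph_adj.2 (Or.inr (by abel))
  have h2 : (SimpleGraph.cycleGraph (n + 4)).Adj t (t - 1) :=
    SimpleGraph.cycleGraph_adj.2 (Or.inl (by abel))
  have hne : t + 1 ≠ t - 1 := by
    intro e
    apply two_ne_zero'
    calc (1 : Fin (n + 4)) + 1 = (t + 1) - (t - 1) := by abel
      _ = 0 := sub_eq_zero.2 e
  have h3 := h _ _ _ (f.map_adj_iff.2 h1) (f.map_adj_iff.2 h2) (f.injective.ne hne) (ht _) (ht _)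
  rcases SimpleGraph.cycleGraph_adj.1 (f.map_adj_iff.1 h3) with e | e
  · apply one_ne_zero (α := Fin (n + 4))
    calc (1 : Fin (n + 4)) = (t + 1) - (t - 1) - 1 := by abel
      _ = 0 := sub_eq_zero.2 e
  · apply three_ne_zero'
    calc (1 : Fin (n + 4)) + 1 + 1 = 1 - ((t - 1) - (t + 1)) := by abel
      _ = 0 := sub_eq_zero.2 e.symm

namespace Otimes

variable {p : ℕ} {a : Fin (2 * p) → ℕ}

/-- Position in a perfect elimination ordering of `otimesGraph a`. -/
def eliminationRank (a : Fin (2 * p) → ℕ) : OtimesVertex a → ℕ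
  | .c => 0
  | .leaf _ _ => 0
  | .path i j => otimesIndex a (.path i j)
  | .clique _ _ => otimesLength a + 1

theorem isChordalGraph (ha : ∀ i, 0 < a i) : IsChordalGraph (otimesGraph a) := by
  refine isChordalGraph_of_rank (eliminationRank a) ?_
  have cc {i i' : Fin p} {j : Fin (a (evenIdx i))} {j' : Fin (a (evenIdx i'))}
      (h : OtimesVertex.clique i j ≠ .clique i' j') := adj_clique_clique.2 h
  have cp {i i' : Fin p} {j : Fin (a (evenIdx i))} {j' : Fin (a (oddIdx i'))} :
      (otimesGraph a).Adj (.clique i j) (.path i' j') := adj_clique_path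
  have pp {i i' : Fin p} {j : Fin (a (oddIdx i))} {j' : Fin (a (oddIdx i'))}
      (h : otimesIndex a (.path i j) = otimesIndex a (.path i' j')) := path_index_inj h
  intro v u w hu hw hne hru hrw
  rcases v with _ | ⟨i, j⟩ | ⟨i, j⟩ | ⟨i, j⟩
  · rcases u with _ | ⟨i₁, j₁⟩ | ⟨i₁, j₁⟩ | ⟨i₁, j₁⟩
    · exact absurd hu (SimpleGraph.irrefl _)
    · rcases w with _ | ⟨i₂, j₂⟩ | ⟨i₂, j₂⟩ | ⟨i₂, j₂⟩
      · exact absurd hw (SimpleGraph.irrefl _)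
      · exact cc hne
      · exact absurd hw.symm not_adj_leaf_c
      · exact cp
    · exact absurd hu.symm not_adj_leaf_c
    · exact absurd hu.symm not_adj_path_c
  · rcases u with _ | ⟨i₁, j₁⟩ | ⟨i₁, j₁⟩ | ⟨i₁, j₁⟩ <;>
      simp only [eliminationRank] at hru
    · omega
    · rcases w with _ | ⟨i₂, j₂⟩ | ⟨i₂, j₂⟩ | ⟨i₂, j₂⟩ <;>
        simp only [eliminationRank] at hrw
      · omega
      · exact cc hne
      · omega
      · exact cp
    · omega
    · have := (path_range ha i₁ j₁).2
      omega
  · rcases u with _ | ⟨i₁, j₁⟩ | ⟨i₁, j₁⟩ | ⟨i₁, j₁⟩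
    · exact absurd hu not_adj_leaf_c
    · rcases w with _ | ⟨i₂, j₂⟩ | ⟨i₂, j₂⟩ | ⟨i₂, j₂⟩
      · exact absurd hw not_adj_leaf_c
      · exact cc hne
      · exact absurd hw not_adj_leaf_leaf
      · exact cp
    · exact absurd hu not_adj_leaf_leaf
    · rcases w with _ | ⟨i₂, j₂⟩ | ⟨i₂, j₂⟩ | ⟨i₂, j₂⟩
      · exact absurd hw not_adj_leaf_c
      · exact cp.symm
      · exact absurd hw not_adj_leaf_leaf
      · refine absurd (pp ?_) hne
        rw [adj_leaf_path ha] at hu hw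
        have r₁ := path_range ha i₁ j₁
        have r₂ := path_range ha i₂ j₂
        -- A leaf of index `s` can only see path vertices of index `s` or `s + 1`, or `ℓ` when `s =
        -- 0`. A clique vertex of its gadget occupies one of `s`, `s + 1`, which leaves room for
        -- only one path neighbour.
        by_cases hj : j.val = 0
        · obtain ⟨m, hm⟩ := clique_of_leaf_ne_last (i := i) (j := j)
            (by have := ha (evenIdx i); omega)
          have := clique_index_ne_path m j₁
          have := clique_index_ne_path m j₂
          omega
        · obtain ⟨m, hm⟩ := clique_of_leaf_ne_zero (i := i) (j := j) hj
          have := clique_index_ne_path m j₁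
          have := clique_index_ne_path m j₂
          have := clique_range ha i m
          omega
  · rcases u with _ | ⟨i₁, j₁⟩ | ⟨i₁, j₁⟩ | ⟨i₁, j₁⟩
    · exact absurd hu not_adj_path_c
    · rcases w with _ | ⟨i₂, j₂⟩ | ⟨i₂, j₂⟩ | ⟨i₂, j₂⟩
      · exact absurd hw not_adj_path_c
      · exact cc hne
      · have := (path_range ha i j).1
        simp only [eliminationRank] at hrw
        omega
      · exact cp
    · have := (path_range ha i j).1
      simp only [eliminationRank] at hru
      omega
    · rcases w with _ | ⟨i₂, j₂⟩ | ⟨i₂, j₂⟩ | ⟨i₂, j₂⟩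
      · exact absurd hw not_adj_path_c
      · exact cp.symm
      · have := (path_range ha i j).1
        simp only [eliminationRank] at hrw
        omega
      · refine absurd (pp ?_) hne
        rw [adj_path_path ha] at hu hw
        simp only [eliminationRank] at hru hrw
        omega

end Otimes

/-! ### Intersection of arcs through their lifts to the line. -/

section Arc

variable {T : ℝ}

theorem mem_circleArc {l r y : ℝ} :
    (y : AddCircle T) ∈ circleArc T l r ↔ ∃ n : ℤ, l ≤ y + n * T ∧ y + n * T ≤ r := by
  constructor
  · rintro ⟨t, ht, e⟩
    have e' : ((t - y : ℝ) : AddCircle T) = 0 := by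
      rw [AddCircle.coe_sub, sub_eq_zero]; exact e
    obtain ⟨n, hn⟩ := (AddCircle.coe_eq_zero_iff T).1 e'
    rw [zsmul_eq_mul] at hn
    have : y + n * T = t := by linarith
    exact ⟨n, by rw [this]; exact ht⟩
  · rintro ⟨n, hn⟩
    refine ⟨y + n * T, hn, ?_⟩
    have : ((n * T : ℝ) : AddCircle T) = 0 :=
      (AddCircle.coe_eq_zero_iff T).2 ⟨n, zsmul_eq_mul _ _⟩
    simp only [AddCircle.coe_add, this, add_zero]

theorem circleArc_inter_nonempty {l r l' r' : ℝ} (h : l ≤ r) (h' : l' ≤ r') :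
    (circleArc T l r ∩ circleArc T l' r').Nonempty ↔
      ∃ n : ℤ, l ≤ r' + n * T ∧ l' + n * T ≤ r := by
  constructor
  · rintro ⟨_, ⟨t, ht, rfl⟩, ht'⟩
    obtain ⟨n, hn, hn'⟩ := mem_circleArc.1 ht'
    refine ⟨-n, ?_, ?_⟩ <;> push_cast <;> linarith [ht.1, ht.2]
  · rintro ⟨n, hn, hn'⟩
    -- Two overlapping intervals share the larger of their left end points.
    refine ⟨((max l (l' + n * T) : ℝ) : AddCircle T), ⟨_, ⟨le_max_left _ _, max_le h hn'⟩, rfl⟩, ?_⟩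
    refine mem_circleArc.2 ⟨-n, ?_, ?_⟩ <;> push_cast
    · linarith [le_max_right l (l' + n * T)]
    · have : max l (l' + n * T) ≤ r' + n * T := max_le hn (by linarith)
      linarith

/-- Arcs with integer end points in the interval `[0, 2N)` on a circle of length `N` intersect
if and only if they do after a shift by at most one turn. -/
theorem circleArc_int_inter_nonempty {N l r l' r' : ℤ} (hT : T = N) (h : l ≤ r) (h' : l' ≤ r')
    (hl : 0 ≤ l) (hr : r < 2 * N) (hl' : 0 ≤ l') (hr' : r' < 2 * N) :
    (circleArc T l r ∩ circleArc T l' r').Nonempty ↔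
      (l ≤ r' ∧ l' ≤ r) ∨ (l ≤ r' + N ∧ l' + N ≤ r) ∨ (l ≤ r' - N ∧ l' - N ≤ r) := by
  subst hT
  rw [circleArc_inter_nonempty (by exact_mod_cast h) (by exact_mod_cast h')]
  constructor
  · rintro ⟨n, hn, hn'⟩
    have hn : l ≤ r' + n * N := by exact_mod_cast hn
    have hn' : l' + n * N ≤ r := by exact_mod_cast hn'
    have h1 : n < 2 := by by_contra; nlinarith
    have h2 : -2 < n := by by_contra; nlinarith
    obtain rfl | rfl | rfl : n = -1 ∨ n = 0 ∨ n = 1 := by omega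
    all_goals omega
  · rintro (⟨hn, hn'⟩ | ⟨hn, hn'⟩ | ⟨hn, hn'⟩)
    · exact ⟨0, by exact_mod_cast (by omega : l ≤ r' + 0 * N),
        by exact_mod_cast (by omega : l' + 0 * N ≤ r)⟩
    · exact ⟨1, by exact_mod_cast (by omega : l ≤ r' + 1 * N),
        by exact_mod_cast (by omega : l' + 1 * N ≤ r)⟩
    · exact ⟨-1, by exact_mod_cast (by omega : l ≤ r' + -1 * N),
        by exact_mod_cast (by omega : l' + -1 * N ≤ r)⟩

theorem mem_circleArc_int {N l r y : ℤ} (hT : T = N)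
    (h : (l ≤ y ∧ y ≤ r) ∨ (l ≤ y + N ∧ y + N ≤ r)) :
    ((y : ℝ) : AddCircle T) ∈ circleArc T l r := by
  subst hT
  rw [mem_circleArc]
  rcases h with ⟨h, h'⟩ | ⟨h, h'⟩
  · exact ⟨0, by exact_mod_cast (by omega : l ≤ y + 0 * N),
      by exact_mod_cast (by omega : y + 0 * N ≤ r)⟩
  · exact ⟨1, by exact_mod_cast (by omega : l ≤ y + 1 * N),
      by exact_mod_cast (by omega : y + 1 * N ≤ r)⟩

end Arc

/-! ### The explicit model of `G - x`. -/

namespace Otimes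

variable {p : ℕ} {a : Fin (2 * p) → ℕ}

/-- The coordinate of the arc of `c` in the model of `G - x`, as an integer. -/
def center (a : Fin (2 * p) → ℕ) (x : OtimesVertex a) : ℤ :=
  match x with
  | .leaf i j =>
      if j.val = 0 then 4 * otimesIndex a x + 4
      else if j.val = a (evenIdx i) then 4 * otimesIndex a x
      else 4 * otimesIndex a x + 2
  | _ => 4 * otimesIndex a x

/-- The left end point of `otimesArc a x u`. -/
def arcLeft (a : Fin (2 * p) → ℕ) (x u : OtimesVertex a) : ℤ :=
  match u, x with
  | .c, x => center a x
  | .leaf i j, _ => 4 * otimesIndex a (.leaf i j) + 2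
  | .path i j, _ => 4 * otimesIndex a (.path i j) - 3
  | .clique i m, .leaf i' j =>
      if i = i' ∧ m.val + 1 = j.val then
        if j.val = a (evenIdx i') then 4 * otimesIndex a (.clique i m)
        else 4 * otimesIndex a (.clique i m) + 1
      else 4 * otimesIndex a (.clique i m) + 3
  | .clique i m, _ => 4 * otimesIndex a (.clique i m) + 3

/-- The right end point of `otimesArc a x u`. -/
def arcRight (a : Fin (2 * p) → ℕ) (x u : OtimesVertex a) : ℤ :=
  match u, x with
  | .c, x => center a x
  | .leaf i j, _ => 4 * otimesIndex a (.leaf i j) + 2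
  | .path i j, _ => 4 * otimesIndex a (.path i j) + 3
  | .clique i m, .leaf i' j =>
      if i = i' ∧ m.val = j.val then
        if j.val = 0 then 4 * otimesIndex a (.clique i m) + 4 * otimesLength a
        else 4 * otimesIndex a (.clique i m) - 1 + 4 * otimesLength a
      else 4 * otimesIndex a (.clique i m) - 3 + 4 * otimesLength a
  | .clique i m, _ => 4 * otimesIndex a (.clique i m) - 3 + 4 * otimesLength a

theorem center_cast (x : OtimesVertex a) : ((center a x : ℤ) : ℝ) = otimesCenter a x := by
  rcases x with _ | ⟨i, j⟩ | ⟨i, j⟩ | ⟨i, j⟩ <;> simp only [center, otimesCenter]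
  all_goals first | (split_ifs <;> push_cast <;> rfl) | (push_cast; rfl)

theorem otimesArc_eq (x u : OtimesVertex a) :
    otimesArc a x u =
      circleArc (4 * (otimesLength a : ℝ)) (arcLeft a x u : ℤ) (arcRight a x u : ℤ) := by
  rcases u with _ | ⟨i, m⟩ | ⟨i, j⟩ | ⟨i, j⟩
  · simp only [arcLeft, arcRight, center_cast]
    rfl
  · rcases x with _ | ⟨i', j'⟩ | ⟨i', j'⟩ | ⟨i', j'⟩
    · simp only [otimesArc, arcLeft, arcRight]; push_cast; rfl
    · simp only [otimesArc, arcLeft, arcRight]; push_cast; rfl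
    · simp only [otimesArc, arcLeft, arcRight]
      by_cases h : i = i' ∧ m.val + 1 = j'.val
      · have h' : ¬ (i = i' ∧ m.val = j'.val) := by omega
        rw [if_pos h, if_pos h, if_neg h']
        split_ifs <;> push_cast <;> rfl
      · rw [if_neg h, if_neg h]
        split_ifs <;> push_cast <;> rfl
    · simp only [otimesArc, arcLeft, arcRight]; push_cast; rfl
  · simp only [otimesArc, arcLeft, arcRight]; push_cast; rfl
  · simp only [otimesArc, arcLeft, arcRight]; push_cast; rfl

/-- The arc of a clique vertex contains the standard arc, and it contains more only next to the
deleted leaf. -/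
theorem clique_arc_spec (ha : ∀ i, 0 < a i) (x : OtimesVertex a) (i : Fin p)
    (m : Fin (a (evenIdx i))) :
    let s : ℤ := otimesIndex a (.clique i m)
    4 * s ≤ arcLeft a x (.clique i m) ∧ arcLeft a x (.clique i m) ≤ 4 * s + 3 ∧
    4 * s - 3 + 4 * otimesLength a ≤ arcRight a x (.clique i m) ∧
    arcRight a x (.clique i m) ≤ 4 * s + 4 * otimesLength a ∧
    (arcLeft a x (.clique i m) ≤ 4 * s + 2 → ∃ i' j, x = .leaf i' j ∧
      otimesIndex a (.leaf i' j) = s) ∧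
    (4 * s - 2 + 4 * otimesLength a ≤ arcRight a x (.clique i m) → ∃ i' j, x = .leaf i' j ∧
      otimesIndex a (.leaf i' j) + 1 = s) := by
  intro s
  rcases x with _ | ⟨i', j'⟩ | ⟨i', j'⟩ | ⟨i', j'⟩
  · simp only [arcLeft, arcRight]
    exact ⟨by omega, by omega, by omega, by omega, fun h => by omega, fun h => by omega⟩
  · simp only [arcLeft, arcRight]
    exact ⟨by omega, by omega, by omega, by omega, fun h => by omega, fun h => by omega⟩
  · simp only [arcLeft, arcRight]
    simp only [succ_eq_leaf_iff ha, eq_leaf_iff ha]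
    refine ⟨?_, ?_, ?_, ?_, fun h => ⟨i', j', rfl, ?_⟩, fun h => ⟨i', j', rfl, ?_⟩⟩
    all_goals split_ifs at * <;> omega
  · simp only [arcLeft, arcRight]
    exact ⟨by omega, by omega, by omega, by omega, fun h => by omega, fun h => by omega⟩

theorem arc_bounds (ha : ∀ i, 0 < a i) (hp : 0 < p) (x u : OtimesVertex a) :
    0 ≤ arcLeft a x u ∧ arcLeft a x u ≤ arcRight a x u ∧
    arcRight a x u ≤ arcLeft a x u + 4 * otimesLength a ∧
    arcRight a x u < 2 * (4 * otimesLength a) := by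
  have hl := path_range ha ⟨0, hp⟩ ⟨0, ha _⟩
  rcases u with _ | ⟨i, m⟩ | ⟨i, j⟩ | ⟨i, j⟩
  · rcases x with _ | ⟨i', j'⟩ | ⟨i', j'⟩ | ⟨i', j'⟩
    · simp only [arcLeft, arcRight, center, otimesIndex]; omega
    · have := clique_range ha i' j'
      simp only [arcLeft, arcRight, center]; omega
    · have := leaf_range ha i' j'
      simp only [arcLeft, arcRight, center]; split_ifs <;> omega
    · have := path_range ha i' j'
      simp only [arcLeft, arcRight, center]; omega
  · have := clique_range ha i m
    rcases x with _ | ⟨i', j'⟩ | ⟨i', j'⟩ | ⟨i', j'⟩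
    · simp only [arcLeft, arcRight]; omega
    · simp only [arcLeft, arcRight]; omega
    · simp only [arcLeft, arcRight]; split_ifs <;> omega
    · simp only [arcLeft, arcRight]; omega
  · have := leaf_range ha i j
    simp only [arcLeft, arcRight]; omega
  · have := path_range ha i j
    simp only [arcLeft, arcRight]; omega

/-- Intersection of two arcs of the model, in terms of their end points. -/
def Meets (a : Fin (2 * p) → ℕ) (x u v : OtimesVertex a) : Prop :=
  (arcLeft a x u ≤ arcRight a x v ∧ arcLeft a x v ≤ arcRight a x u) ∨
  (arcLeft a x u ≤ arcRight a x v + 4 * otimesLength a ∧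
    arcLeft a x v + 4 * otimesLength a ≤ arcRight a x u) ∨
  (arcLeft a x u ≤ arcRight a x v - 4 * otimesLength a ∧
    arcLeft a x v - 4 * otimesLength a ≤ arcRight a x u)

theorem meets_iff (ha : ∀ i, 0 < a i) (hp : 0 < p) (x u v : OtimesVertex a) :
    (otimesArc a x u ∩ otimesArc a x v).Nonempty ↔ Meets a x u v := by
  rw [otimesArc_eq, otimesArc_eq, Meets]
  obtain ⟨h1, h2, h3, h4⟩ := arc_bounds ha hp x u
  obtain ⟨h1', h2', h3', h4'⟩ := arc_bounds ha hp x v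
  exact circleArc_int_inter_nonempty (by push_cast; rfl) h2 h2' h1 h4 h1' h4'

theorem mem_otimesArc {x u : OtimesVertex a} {y : ℤ}
    (h : (arcLeft a x u ≤ y ∧ y ≤ arcRight a x u) ∨
      (arcLeft a x u ≤ y + 4 * otimesLength a ∧ y + 4 * otimesLength a ≤ arcRight a x u)) :
    ((y : ℝ) : AddCircle (4 * (otimesLength a : ℝ))) ∈ otimesArc a x u := by
  rw [otimesArc_eq]
  exact mem_circleArc_int (by push_cast; rfl) h

theorem meets_comm (x u v : OtimesVertex a) : Meets a x u v ↔ Meets a x v u := by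
  unfold Meets
  constructor <;> rintro (h | h | h) <;> omega

/-- The gap of a standard clique arc lies around `4s`. It contains the point of `c` only when `x` is
a leaf missed by the clique vertex, and then the arc is extended to reach that point. -/
theorem meets_clique_c (ha : ∀ i, 0 < a i) (x : OtimesVertex a) (hx : x ≠ .c)
    (i : Fin p) (m : Fin (a (evenIdx i))) (hu : OtimesVertex.clique i m ≠ x) :
    Meets a x (.clique i m) .c := by
  obtain ⟨h1, h2, h3, h4, -, -⟩ := clique_arc_spec ha x i m
  have hr := clique_range ha i m
  rcases x with _ | ⟨i', j'⟩ | ⟨i', j'⟩ | ⟨i', j'⟩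
  · exact absurd rfl hx
  · have := mt clique_index_inj hu
    have := clique_range ha i' j'
    simp only [Meets, show ∀ x, arcLeft a x .c = center a x from fun _ => rfl,
      show ∀ x, arcRight a x .c = center a x from fun _ => rfl, center] at *
    omega
  · have hr' := leaf_range ha i' j'
    simp only [Meets, arcLeft, arcRight, center, succ_eq_leaf_iff ha, eq_leaf_iff ha]
    split_ifs <;> omega
  · have := clique_index_ne_path m j'
    have := path_range ha i' j'
    simp only [Meets, show ∀ x, arcLeft a x .c = center a x from fun _ => rfl,
      show ∀ x, arcRight a x .c = center a x from fun _ => rfl, center] at *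
    omega

/-- Leaves sit at coordinates congruent to 2 modulo 4. The point of `c` has such a coordinate only
when it takes the place of a deleted inner leaf. -/
theorem not_meets_leaf_c (ha : ∀ i, 0 < a i) (x : OtimesVertex a)
    (i : Fin p) (j : Fin (a (evenIdx i) + 1)) (hu : OtimesVertex.leaf i j ≠ x) :
    ¬ Meets a x (.leaf i j) .c := by
  have hr := leaf_range ha i j
  rcases x with _ | ⟨i', j'⟩ | ⟨i', j'⟩ | ⟨i', j'⟩
  · simp only [Meets, arcLeft, arcRight, center]; omega
  · simp only [Meets, arcLeft, arcRight, center]; omega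
  · have := mt (leaf_index_inj ha) hu
    have := leaf_range ha i' j'
    simp only [Meets, arcLeft, arcRight, center]
    split_ifs <;> omega
  · simp only [Meets, arcLeft, arcRight, center]; omega

theorem not_meets_path_c (ha : ∀ i, 0 < a i) (x : OtimesVertex a) (hx : x ≠ .c)
    (i : Fin p) (j : Fin (a (oddIdx i))) (hu : OtimesVertex.path i j ≠ x) :
    ¬ Meets a x (.path i j) .c := by
  have hr := path_range ha i j
  rcases x with _ | ⟨i', j'⟩ | ⟨i', j'⟩ | ⟨i', j'⟩
  · exact absurd rfl hx
  · have := clique_index_ne_path j' j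
    have := clique_range ha i' j'
    simp only [Meets, arcLeft, arcRight, center]; omega
  · have hl := leaf_range ha i' j'
    -- A path arc reaches only 3 to each side of its centre, so it suffices that the indices nearest
    -- to the point of `c` belong to clique vertices.
    have hz : j'.val ≠ 0 → otimesIndex a (.path i j) ≠ otimesIndex a (.leaf i' j') := by
      intro h
      obtain ⟨m, hm⟩ := clique_of_leaf_ne_zero (i := i') (j := j') h
      rw [← hm]
      exact (clique_index_ne_path m j).symm
    have hz' : j'.val ≠ a (evenIdx i') →
        otimesIndex a (.path i j) ≠ otimesIndex a (.leaf i' j') + 1 ∧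
        otimesIndex a (.leaf i' j') + 1 < otimesLength a := by
      intro h
      obtain ⟨m, hm⟩ := clique_of_leaf_ne_last (i := i') (j := j') h
      rw [← hm]
      exact ⟨(clique_index_ne_path m j).symm, (clique_range ha _ m).2⟩
    have h0 : j'.val ≠ 0 → 0 < otimesIndex a (.leaf i' j') := by
      rw [index_leaf]; omega
    have := ha (evenIdx i')
    simp only [Meets, arcLeft, arcRight, center]
    split_ifs <;> omega
  · have := mt path_index_inj hu
    have := path_range ha i' j'
    simp only [Meets, arcLeft, arcRight, center]; omega

/-- Clique indices lie strictly between `0` and `ℓ`, so every clique arc contains coordinate `0`. -/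
theorem meets_clique_clique (ha : ∀ i, 0 < a i) (x : OtimesVertex a)
    (i i' : Fin p) (m : Fin (a (evenIdx i))) (m' : Fin (a (evenIdx i'))) :
    Meets a x (.clique i m) (.clique i' m') := by
  obtain ⟨h1, h2, h3, h4, -, -⟩ := clique_arc_spec ha x i m
  obtain ⟨h1', h2', h3', h4', -, -⟩ := clique_arc_spec ha x i' m'
  have := clique_range ha i m
  have := clique_range ha i' m'
  unfold Meets
  omega

theorem meets_clique_path (ha : ∀ i, 0 < a i) (x : OtimesVertex a)
    (i i' : Fin p) (m : Fin (a (evenIdx i))) (j : Fin (a (oddIdx i'))) :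
    Meets a x (.clique i m) (.path i' j) := by
  obtain ⟨h1, h2, h3, h4, -, -⟩ := clique_arc_spec ha x i m
  have := clique_range ha i m
  have := path_range ha i' j
  have := clique_index_ne_path m j
  simp only [Meets, show ∀ x, arcLeft a x (.path i' j) = 4 * otimesIndex a (.path i' j) - 3
      from fun _ => rfl,
    show ∀ x, arcRight a x (.path i' j) = 4 * otimesIndex a (.path i' j) + 3 from fun _ => rfl]
  omega

/-- The gap of the standard arc, from `4s - 3` to `4s + 3`, contains precisely the leaf points `4s -
2` and `4s + 2`. An extended arc can recover only the point of the deleted leaf, which `hx` rules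
out. -/
theorem meets_clique_leaf_iff (ha : ∀ i, 0 < a i) (x : OtimesVertex a)
    (i i' : Fin p) (m : Fin (a (evenIdx i))) (j : Fin (a (evenIdx i') + 1))
    (hx : OtimesVertex.leaf i' j ≠ x) :
    Meets a x (.clique i m) (.leaf i' j) ↔
      otimesIndex a (.clique i m) ≠ otimesIndex a (.leaf i' j) ∧
      otimesIndex a (.clique i m) ≠ otimesIndex a (.leaf i' j) + 1 := by
  obtain ⟨h1, h2, h3, h4, h5, h6⟩ := clique_arc_spec ha x i m
  have := clique_range ha i m
  have := leaf_range ha i' j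
  have h5' : otimesIndex a (.clique i m) = otimesIndex a (.leaf i' j) →
      4 * (otimesIndex a (.clique i m) : ℤ) + 3 ≤ arcLeft a x (.clique i m) := by
    intro e
    by_contra hlt
    obtain ⟨i'', j'', rfl, e'⟩ := h5 (by omega)
    exact hx (leaf_index_inj ha (by omega))
  have h6' : otimesIndex a (.clique i m) = otimesIndex a (.leaf i' j) + 1 →
      arcRight a x (.clique i m) ≤ 4 * otimesIndex a (.clique i m) - 3 + 4 * otimesLength a := by
    intro e
    by_contra hlt
    obtain ⟨i'', j'', rfl, e'⟩ := h6 (by omega)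
    exact hx (leaf_index_inj ha (by omega))
  simp only [Meets, show ∀ x, arcLeft a x (.leaf i' j) = 4 * otimesIndex a (.leaf i' j) + 2
      from fun _ => rfl,
    show ∀ x, arcRight a x (.leaf i' j) = 4 * otimesIndex a (.leaf i' j) + 2 from fun _ => rfl]
  constructor <;> omega

theorem adj_iff_meets (ha : ∀ i, 0 < a i) (x u v : OtimesVertex a) (hu : u ≠ x)
    (hv : v ≠ x) (huv : u ≠ v) : (otimesGraph a).Adj u v ↔ Meets a x u v := by
  have cc (i m) (hx : OtimesVertex.c ≠ x) (h : OtimesVertex.clique i m ≠ x) :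
      (otimesGraph a).Adj (.clique i m) .c ↔ Meets a x (.clique i m) .c :=
    iff_of_true adj_clique_c (meets_clique_c ha x hx.symm i m h)
  have lc (i j) (h : OtimesVertex.leaf i j ≠ x) :
      (otimesGraph a).Adj (.leaf i j) .c ↔ Meets a x (.leaf i j) .c :=
    iff_of_false not_adj_leaf_c (not_meets_leaf_c ha x i j h)
  have pc (i j) (hx : OtimesVertex.c ≠ x) (h : OtimesVertex.path i j ≠ x) :
      (otimesGraph a).Adj (.path i j) .c ↔ Meets a x (.path i j) .c :=
    iff_of_false not_adj_path_c (not_meets_path_c ha x hx.symm i j h)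
  have cl (i m i' j) (h : OtimesVertex.leaf i' j ≠ x) :
      (otimesGraph a).Adj (.clique i m) (.leaf i' j) ↔ Meets a x (.clique i m) (.leaf i' j) :=
    (adj_clique_leaf ha).trans (meets_clique_leaf_iff ha x i i' m j h).symm
  have cp (i m i' j) :
      (otimesGraph a).Adj (.clique i m) (.path i' j) ↔ Meets a x (.clique i m) (.path i' j) :=
    iff_of_true adj_clique_path (meets_clique_path ha x i i' m j)
  have lp (i j i' j') :
      (otimesGraph a).Adj (.leaf i j) (.path i' j') ↔ Meets a x (.leaf i j) (.path i' j') := by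
    rw [adj_leaf_path ha]
    have := leaf_range ha i j
    have := path_range ha i' j'
    simp only [Meets, arcLeft, arcRight]
    omega
  rcases u with _ | ⟨i, j⟩ | ⟨i, j⟩ | ⟨i, j⟩ <;> rcases v with _ | ⟨i', j'⟩ | ⟨i', j'⟩ | ⟨i', j'⟩
  · exact absurd rfl huv
  · rw [SimpleGraph.adj_comm, meets_comm]; exact cc _ _ hu hv
  · rw [SimpleGraph.adj_comm, meets_comm]; exact lc _ _ hv
  · rw [SimpleGraph.adj_comm, meets_comm]; exact pc _ _ hu hv
  · exact cc _ _ hv hu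
  · exact iff_of_true (adj_clique_clique.2 huv) (meets_clique_clique ha x i i' j j')
  · exact cl _ _ _ _ hv
  · exact cp _ _ _ _
  · exact lc _ _ hu
  · rw [SimpleGraph.adj_comm, meets_comm]; exact cl _ _ _ _ hu
  · refine iff_of_false not_adj_leaf_leaf ?_
    have := mt (leaf_index_inj ha) huv
    have := leaf_range ha i j
    have := leaf_range ha i' j'
    simp only [Meets, arcLeft, arcRight]
    omega
  · exact lp _ _ _ _
  · exact pc _ _ hv hu
  · rw [SimpleGraph.adj_comm, meets_comm]; exact cp _ _ _ _
  · rw [SimpleGraph.adj_comm, meets_comm]; exact lp _ _ _ _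
  · rw [adj_path_path ha]
    have := mt path_index_inj huv
    have := path_range ha i j
    have := path_range ha i' j'
    simp only [Meets, arcLeft, arcRight]
    omega

/-! ### The Helly property. -/

theorem length_pos (ha : ∀ i, 0 < a i) (hp : 0 < p) : 2 ≤ otimesLength a := by
  have := path_range ha ⟨0, hp⟩ ⟨0, ha _⟩
  omega

theorem isHellyCircularArcModel (ha : ∀ i, 0 < a i) (hp : 0 < p) (x : OtimesVertex a) :
    IsHellyCircularArcModel ((otimesGraph a).induce {x}ᶜ) (4 * (otimesLength a : ℝ))
      (fun u => otimesArc a x u.val) := by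
  refine ⟨⟨fun u => ?_, fun u v huv => ?_⟩, fun K hK => ?_⟩
  · obtain ⟨h1, h2, h3, h4⟩ := arc_bounds ha hp x u.val
    exact ⟨_, _, by exact_mod_cast h2, by exact_mod_cast h3, otimesArc_eq x u.val⟩
  · rw [meets_iff ha hp, ← adj_iff_meets ha x u.val v.val u.2 v.2 (Subtype.coe_injective.ne huv)]
    rfl
  have hpoint (u : ↥({x}ᶜ : Set (OtimesVertex a))) (hu : u ∈ K) (t : ℝ)
      (ht : otimesArc a x u.val = circleArc _ t t) :
      (⋂ v ∈ K, otimesArc a x v.val).Nonempty := by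
    refine ⟨((t : ℝ) : AddCircle _), Set.mem_iInter₂.2 fun v hv => ?_⟩
    obtain ⟨y, hy, hy'⟩ := hK u hu v hv
    simp only [ht, circleArc, Set.Icc_self, Set.image_singleton, Set.mem_singleton_iff] at hy
    rwa [hy] at hy'
  have hadj (u v : OtimesVertex a) (hu : u ∈ Subtype.val '' K) (hv : v ∈ Subtype.val '' K)
      (huv : u ≠ v) : (otimesGraph a).Adj u v := by
    obtain ⟨u, hu, rfl⟩ := hu
    obtain ⟨v, hv, rfl⟩ := hv
    rw [adj_iff_meets ha x u.val v.val u.2 v.2 huv, ← meets_iff ha hp]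
    exact hK u hu v hv
  by_cases hc : OtimesVertex.c ∈ Subtype.val '' K
  · obtain ⟨u, hu, e⟩ := hc
    exact hpoint u hu (otimesCenter a x) (by rw [e]; rfl)
  by_cases hleaf : ∃ i j, OtimesVertex.leaf i j ∈ Subtype.val '' K
  · obtain ⟨i, j, u, hu, e⟩ := hleaf
    exact hpoint u hu (4 * (otimesIndex a (.leaf i j) : ℝ) + 2) (by rw [e]; rfl)
  push Not at hleaf
  suffices h : ∃ y : ℤ, ∀ v ∈ Subtype.val '' K,
      ((y : ℝ) : AddCircle (4 * (otimesLength a : ℝ))) ∈ otimesArc a x v by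
    obtain ⟨y, hy⟩ := h
    exact ⟨_, Set.mem_iInter₂.2 fun v hv => hy _ ⟨v, hv, rfl⟩⟩
  have hpath (i j) : ∀ x, arcLeft a x (.path i j) = 4 * otimesIndex a (.path i j) - 3 ∧
    arcRight a x (.path i j) = 4 * otimesIndex a (.path i j) + 3 := fun _ => ⟨rfl, rfl⟩
  by_cases hP : ∃ i j, OtimesVertex.path i j ∈ Subtype.val '' K
  · obtain ⟨i, j, hij⟩ := hP
    have hr := path_range ha i j
    by_cases hP' : ∃ i' j', OtimesVertex.path i' j' ∈ Subtype.val '' K ∧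
        OtimesVertex.path i' j' ≠ .path i j
    · obtain ⟨i', j', hij', hne⟩ := hP'
      have hr' := path_range ha i' j'
      have h1 := (adj_path_path ha).1 (hadj _ _ hij hij' hne.symm)
      -- The midpoint of the centres of two consecutive path arcs. It lies outside the gap of every
      -- clique vertex, and no third path vertex is adjacent to both.
      refine ⟨2 * (otimesIndex a (.path i j) + otimesIndex a (.path i' j')), ?_⟩
      rintro (_ | ⟨i₁, j₁⟩ | ⟨i₁, j₁⟩ | ⟨i₁, j₁⟩) hv
      · exact absurd hv hc
      · apply mem_otimesArc
        obtain ⟨k1, k2, k3, k4, -, -⟩ := clique_arc_spec ha x i₁ j₁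
        have := clique_range ha i₁ j₁
        have := clique_index_ne_path j₁ j
        have := clique_index_ne_path j₁ j'
        omega
      · exact absurd hv (hleaf _ _)
      · apply mem_otimesArc
        have h2 : OtimesVertex.path i j = .path i₁ j₁ ∨ _ :=
          (em _).imp_right fun h => (adj_path_path ha).1 (hadj _ _ hij hv h)
        have h3 : OtimesVertex.path i' j' = .path i₁ j₁ ∨ _ :=
          (em _).imp_right fun h => (adj_path_path ha).1 (hadj _ _ hij' hv h)
        have h2 := h2.imp_left (congrArg (otimesIndex a))
        have h3 := h3.imp_left (congrArg (otimesIndex a))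
        have := hpath i₁ j₁ x
        omega
    · push Not at hP'
      refine ⟨4 * otimesIndex a (.path i j), ?_⟩
      rintro (_ | ⟨i₁, j₁⟩ | ⟨i₁, j₁⟩ | ⟨i₁, j₁⟩) hv
      · exact absurd hv hc
      · apply mem_otimesArc
        obtain ⟨k1, k2, k3, k4, -, -⟩ := clique_arc_spec ha x i₁ j₁
        have := clique_range ha i₁ j₁
        have := clique_index_ne_path j₁ j
        omega
      · exact absurd hv (hleaf _ _)
      · rw [hP' _ _ hv]
        apply mem_otimesArc
        have := hpath i j x
        omega
  · push Not at hP
    -- Only clique vertices remain, and coordinate `0` is outside all their gaps.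
    refine ⟨0, ?_⟩
    rintro (_ | ⟨i₁, j₁⟩ | ⟨i₁, j₁⟩ | ⟨i₁, j₁⟩) hv
    · exact absurd hv hc
    · apply mem_otimesArc
      obtain ⟨k1, k2, k3, k4, -, -⟩ := clique_arc_spec ha x i₁ j₁
      have := clique_range ha i₁ j₁
      omega
    · exact absurd hv (hleaf _ _)
    · exact absurd hv (hP _ _)

theorem isHellyCircularArcGraph (ha : ∀ i, 0 < a i) (hp : 0 < p) (x : OtimesVertex a) :
    IsHellyCircularArcGraph ((otimesGraph a).induce {x}ᶜ) := by
  refine ⟨_, ?_, _, isHellyCircularArcModel ha hp x⟩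
  have : (2 : ℝ) ≤ otimesLength a := by exact_mod_cast length_pos ha hp
  linarith

end Otimes

/-! ### An obstruction to circular-arc models. -/

section Obstruction

variable {V : Type*} {G : SimpleGraph V}

/-- An arc disjoint from the arc `[l, r]` lifts to an interval strictly between `r` and `l + T`. -/
theorem exists_lift_of_disjoint {T l r l' r' : ℝ} (hT : 0 < T) (h : l ≤ r) (h' : l' ≤ r')
    (hd : ¬ (circleArc T l r ∩ circleArc T l' r').Nonempty) :
    ∃ n : ℤ, r < l' + n * T ∧ r' + n * T < l + T := by
  obtain ⟨n, hn, -⟩ := existsUnique_add_zsmul_mem_Ioc hT l' r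
  simp only [zsmul_eq_mul, Set.mem_Ioc] at hn
  refine ⟨n, hn.1, ?_⟩
  by_contra hlt
  refine hd ((circleArc_inter_nonempty h h').2 ⟨n - 1, ?_, ?_⟩) <;> push_cast <;> linarith

/-- In a circular-arc graph, the vertices not adjacent to `c` are represented by real intervals,
and a neighbour of `c` that misses two of them misses every interval in between. -/
theorem IsCircularArcGraph.exists_intervals (hG : IsCircularArcGraph G) (c : V) :
    ∃ l r : V → ℝ,
      (∀ u, u ≠ c → ¬ G.Adj c u → l u ≤ r u) ∧
      (∀ u u', u ≠ u' → u ≠ c → ¬ G.Adj c u → u' ≠ c → ¬ G.Adj c u' →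
        (G.Adj u u' ↔ l u ≤ r u' ∧ l u' ≤ r u)) ∧
      ∀ v u y u', G.Adj c v → u ≠ c → ¬ G.Adj c u → y ≠ c → ¬ G.Adj c y → u' ≠ c →
        ¬ G.Adj c u' → ¬ G.Adj v u → ¬ G.Adj v u' → r u < l y → r y < l u' → ¬ G.Adj v y := by
  obtain ⟨T, hT, A, hA, hadj⟩ := hG
  choose l r hlr hrT hA using hA
  have hadj' (u v : V) (huv : u ≠ v) :
      G.Adj u v ↔ ∃ n : ℤ, l u ≤ r v + n * T ∧ l v + n * T ≤ r u := by
    rw [hadj u v huv, hA u, hA v, circleArc_inter_nonempty (hlr u) (hlr v)]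
  -- All non-neighbours of `c` are lifted into the same window, the complement of the arc of `c`.
  -- For other vertices the shift `0` is a dummy value.
  have hlift (u : V) : ∃ n : ℤ, u ≠ c → ¬ G.Adj c u → r c < l u + n * T ∧ r u + n * T < l c + T := by
    by_cases hu : u ≠ c ∧ ¬ G.Adj c u
    · obtain ⟨n, hn⟩ := exists_lift_of_disjoint hT (hlr c) (hlr u)
        (by rw [← hA c, ← hA u, ← hadj c u hu.1.symm]; exact hu.2)
      exact ⟨n, fun _ _ => hn⟩
    · exact ⟨0, fun h h' => absurd ⟨h, h'⟩ hu⟩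
  choose k hk using hlift
  have hc := hlr c
  refine ⟨fun u => l u + k u * T, fun u => r u + k u * T, fun u _ _ => ?_, ?_, ?_⟩
  · linarith [hlr u]
  · intro u u' hne hu hcu hu' hcu'
    obtain ⟨h1, h2⟩ := hk u hu hcu
    obtain ⟨h1', h2'⟩ := hk u' hu' hcu'
    have := hlr u
    have := hlr u'
    rw [hadj' u u' hne]
    constructor
    · rintro ⟨n, hn, hn'⟩
      -- `d` is the shift between the chosen lifts. As the window is no longer than one turn, only
      -- `d = 0` allows an intersection.
      obtain ⟨d, hd⟩ : ∃ d : ℤ, d = n + k u - k u' := ⟨_, rfl⟩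
      have hnd : (n : ℝ) = d - k u + k u' := by rw [hd]; push_cast; ring
      rw [hnd] at hn hn'
      rcases lt_trichotomy d 0 with h | h | h
      · have : (d : ℝ) ≤ -1 := by exact_mod_cast (by omega : d ≤ -1)
        nlinarith
      · rw [h] at hn hn'
        push_cast at hn hn'
        constructor <;> linarith
      · have : (1 : ℝ) ≤ d := by exact_mod_cast h
        nlinarith
    · rintro ⟨hn, hn'⟩
      refine ⟨k u' - k u, ?_, ?_⟩ <;> push_cast <;> linarith
  · intro v u y u' hv hu hcu hy hcy hu' hcu' hvu hvu' huy hyu' hvy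
    obtain ⟨h1, h2⟩ := hk u hu hcu
    obtain ⟨h1', h2'⟩ := hk u' hu' hcu'
    have := hlr u
    have := hlr u'
    have := hlr v
    have hne (w : V) (hw : ¬ G.Adj c w) : v ≠ w := by rintro rfl; exact hw hv
    obtain ⟨n, hn, hn'⟩ := (hadj' c v hv.ne).1 hv
    -- The lift of `v` that meets `c` is trapped between `u'` shifted back one turn and `u`, so no
    -- translate of the intermediate `y` can reach it.
    have hvl : r v + n * T < l u + k u * T := by
      by_contra h
      refine hvu ((hadj' v u (hne u hcu)).2 ⟨k u - n, ?_, ?_⟩) <;> push_cast <;> linarith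
    have hvr : r u' + k u' * T - T < l v + n * T := by
      by_contra h
      refine hvu' ((hadj' v u' (hne u' hcu')).2 ⟨k u' - n - 1, ?_, ?_⟩) <;> push_cast <;> linarith
    obtain ⟨m, hm, hm'⟩ := (hadj' v y (hne y hcy)).1 hvy
    obtain ⟨d, hd⟩ : ∃ d : ℤ, d = m + n - k y := ⟨_, rfl⟩
    have hmd : (m : ℝ) = d - n + k y := by rw [hd]; push_cast; ring
    rw [hmd] at hm hm'
    rcases lt_or_ge d 0 with h | h
    · have : (d : ℝ) ≤ -1 := by exact_mod_cast (by omega : d ≤ -1)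
      nlinarith
    · have : (0 : ℝ) ≤ d := by exact_mod_cast h
      nlinarith

/-- Let `e 0, …, e (n - 1)` be a cyclic sequence of vertices not adjacent to `c` in a circular-arc
graph, in which cyclically consecutive vertices are adjacent or are the only ones missed by some
neighbour of `c`, and other pairs are not adjacent. Then the non-adjacency graph of the sequence is
bipartite. -/
theorem IsCircularArcGraph.exists_bipartition (hG : IsCircularArcGraph G) {c : V} {n : ℕ}
    (hn : 4 ≤ n) (e : ℕ → V) (hc : ∀ t, e t ≠ c) (hcadj : ∀ t, ¬ G.Adj c (e t))
    (hper : ∀ t, e (t + n) = e t) (hinj : ∀ t s, 0 < s → s < n → e t ≠ e (t + s))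
    (hlink : ∀ t, G.Adj (e t) (e (t + 1)) ∨ ∃ v, G.Adj c v ∧ ¬ G.Adj v (e t) ∧
      ¬ G.Adj v (e (t + 1)) ∧ ∀ s, e s ≠ e t → e s ≠ e (t + 1) → G.Adj v (e s))
    (hfar : ∀ t s, 2 ≤ s → s + 2 ≤ n → ¬ G.Adj (e t) (e (t + s))) :
    ∃ σ : ℕ → Prop, ∀ t s, 0 < s → s < n → ¬ G.Adj (e t) (e (t + s)) → (σ t ↔ ¬ σ (t + s)) := by
  obtain ⟨l, r, hlr, hadj, hbetween⟩ := hG.exists_intervals c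
  have hle (t : ℕ) : l (e t) ≤ r (e t) := hlr _ (hc t) (hcadj t)
  have hadj (t s : ℕ) (h : e t ≠ e s) : G.Adj (e t) (e s) ↔
      l (e t) ≤ r (e s) ∧ l (e s) ≤ r (e t) := hadj _ _ h (hc t) (hcadj t) (hc s) (hcadj s)
  have hbetween (v : V) (hv : G.Adj c v) (u y u' : ℕ) (h : ¬ G.Adj v (e u))
      (h' : ¬ G.Adj v (e u')) (hy : G.Adj v (e y)) : ¬ (r (e u) < l (e y) ∧ r (e y) < l (e u')) :=
    fun hlt => hbetween v _ _ _ hv (hc u) (hcadj u) (hc y) (hcadj y) (hc u') (hcadj u') h h'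
      hlt.1 hlt.2 hy
  have hside (t s : ℕ) (h : e t ≠ e s) (h' : ¬ G.Adj (e t) (e s)) :
      r (e t) < l (e s) ∨ r (e s) < l (e t) := by
    rw [hadj t s h] at h'
    by_contra! hcon
    exact h' hcon.symm
  -- Two consecutive members, both non-adjacent to `e t`, lie on the same side of it: either they
  -- overlap, or some `v` misses both but meets `e t`, which therefore is not between them.
  have hstep (t s : ℕ) (hs : 0 < s) (hs' : s + 1 < n) (h : ¬ G.Adj (e t) (e (t + s)))
      (h' : ¬ G.Adj (e t) (e (t + s + 1))) :
      r (e t) < l (e (t + s)) ↔ r (e t) < l (e (t + s + 1)) := by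
    have hne := hinj t s hs (by omega)
    have hne' := hinj t (s + 1) (by omega) hs'
    have h1 := hside _ _ hne h
    have h2 := hside _ _ hne' h'
    have := hle t
    have := hle (t + s)
    have := hle (t + s + 1)
    have key : ¬ (r (e (t + s)) < l (e t) ∧ r (e t) < l (e (t + s + 1))) ∧
        ¬ (r (e (t + s + 1)) < l (e t) ∧ r (e t) < l (e (t + s))) := by
      rcases hlink (t + s) with hl | ⟨v, hv, hv1, hv2, hv3⟩
      · rw [hadj _ _ (hinj (t + s) 1 (by omega) (by omega))] at hl
        constructor <;> rintro ⟨_, _⟩ <;> linarith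
      · exact ⟨hbetween v hv _ _ _ hv1 hv2 (hv3 t hne hne'),
          hbetween v hv _ _ _ hv2 hv1 (hv3 t hne hne')⟩
    constructor
    · intro h3
      exact h2.resolve_right fun h4 => key.2 ⟨h4, h3⟩
    · intro h3
      exact h1.resolve_right fun h4 => key.1 ⟨h4, h3⟩
  have hchain (t s : ℕ) (hs : 2 ≤ s) (hs' : s + 2 ≤ n) :
      r (e t) < l (e (t + 2)) ↔ r (e t) < l (e (t + s)) := by
    induction s, hs using Nat.le_induction with
    | base => rfl
    | succ s hs ih =>
      exact (ih (by omega)).trans (hstep t s (by omega) (by omega) (hfar t s hs (by omega))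
        (hfar t (s + 1) (by omega) hs'))
  have hall (t s : ℕ) (hs : 0 < s) (hs' : s < n) (h : ¬ G.Adj (e t) (e (t + s))) :
      r (e t) < l (e (t + 2)) ↔ r (e t) < l (e (t + s)) := by
    rcases Nat.lt_or_ge s 2 with h2 | h2
    · obtain rfl : s = 1 := by omega
      exact (hstep t 1 (by omega) (by omega) h (hfar t 2 le_rfl hn)).symm
    · rcases Nat.lt_or_ge n (s + 2) with h3 | h3
      · obtain ⟨s, rfl⟩ : ∃ s', s = s' + 1 := ⟨s - 1, by omega⟩
        exact (hchain t s (by omega) (by omega)).trans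
          (hstep t s (by omega) hs' (hfar t s (by omega) (by omega)) h)
      · exact hchain t s h2 h3
  -- By `hall`, the side of `e (t + 2)` is the side of every non-neighbour of `e t`. Reading a
  -- non-adjacent pair from its other end, `n - s` steps further on, gives the opposite side.
  refine ⟨fun t => r (e t) < l (e (t + 2)), fun t s hs hs' h => ?_⟩
  have hback : e (t + s + (n - s)) = e t := by
    rw [show t + s + (n - s) = t + n by omega, hper]
  have h1 := hall t s hs hs' h
  have h2 := hall (t + s) (n - s) (by omega) (by omega)
    (by rw [hback]; exact fun h' => h h'.symm)
  rw [hback] at h2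
  simp only [h1, h2]
  have := hle t
  have := hle (t + s)
  constructor
  · intro h3 h4
    linarith
  · exact fun h3 => (hside _ _ (hinj t s hs hs') h).resolve_right h3

end Obstruction

/-! ### The cyclic sequence of leaves and path vertices. -/

namespace Otimes

variable {p : ℕ} {a : Fin (2 * p) → ℕ}

/-- The leaves and path vertices. -/
def IsOuter : OtimesVertex a → Prop
  | .leaf _ _ => True
  | .path _ _ => True
  | _ => False

/-- The position of a leaf or path vertex in the cyclic order, starting with the first leaf. -/
def position (a : Fin (2 * p) → ℕ) : OtimesVertex a → ℕ
  | .leaf i j => prefixSum a (2 * i) + i + j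
  | .path i j => prefixSum a (2 * i + 1) + i + 1 + j
  | _ => 0

/-- The cyclic successor of a leaf or path vertex. -/
def next (hp : 0 < p) (ha : ∀ i, 0 < a i) : OtimesVertex a → OtimesVertex a
  | .leaf i j =>
      if h : j.val < a (evenIdx i) then .leaf i ⟨j + 1, by omega⟩ else .path i ⟨0, ha _⟩
  | .path i j =>
      if h : j.val + 1 < a (oddIdx i) then .path i ⟨j + 1, h⟩
      else .leaf ⟨(i + 1) % p, Nat.mod_lt _ hp⟩ ⟨0, Nat.succ_pos _⟩
  | u => u

theorem isOuter_next (hp : 0 < p) (ha : ∀ i, 0 < a i) {u : OtimesVertex a} (hu : IsOuter u) :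
    IsOuter (next hp ha u) := by
  rcases u with _ | ⟨i, j⟩ | ⟨i, j⟩ | ⟨i, j⟩
  · exact hu
  · exact hu
  · simp only [next]; split_ifs <;> trivial
  · simp only [next]; split_ifs <;> trivial

/-- Each of the `p` gadgets has one leaf more than it has clique vertices, whence the length `ℓ +
p`. -/
theorem position_lt (ha : ∀ i, 0 < a i) {u : OtimesVertex a} (hu : IsOuter u) :
    position a u < otimesLength a + p := by
  rcases u with _ | ⟨i, j⟩ | ⟨i, j⟩ | ⟨i, j⟩
  · exact hu.elim
  · exact hu.elim
  · have := leaf_range ha i j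
    rw [index_leaf] at this
    simp only [position]
    omega
  · have := path_range ha i j
    rw [index_path] at this
    simp only [position]
    omega

theorem position_inj {u v : OtimesVertex a} (hu : IsOuter u) (hv : IsOuter v)
    (h : position a u = position a v) : u = v := by
  have key (i i' : Fin p) : prefixSum a (2 * i + 1) = prefixSum a (2 * i) + a (evenIdx i) ∧
      prefixSum a (2 * i + 2) = prefixSum a (2 * i + 1) + a (oddIdx i) ∧
      (i = i' ∨ (i.val < i'.val ∧ prefixSum a (2 * i + 2) ≤ prefixSum a (2 * i')) ∨
      (i'.val < i.val ∧ prefixSum a (2 * i' + 2) ≤ prefixSum a (2 * i))) :=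
    ⟨prefixSum_even i, prefixSum_odd i, prefixSum_trichotomy i i'⟩
  rcases u with _ | ⟨i, j⟩ | ⟨i, j⟩ | ⟨i, j⟩
  · exact hu.elim
  · exact hu.elim
  · rcases v with _ | ⟨i', j'⟩ | ⟨i', j'⟩ | ⟨i', j'⟩
    · exact hv.elim
    · exact hv.elim
    all_goals
      obtain ⟨h1, h2, h3⟩ := key i i'
      obtain ⟨h1', h2', -⟩ := key i' i
      simp only [position] at h
      rcases h3 with rfl | h3 | h3
    · rw [show j = j' from Fin.ext (by omega)]
    all_goals omega
  · rcases v with _ | ⟨i', j'⟩ | ⟨i', j'⟩ | ⟨i', j'⟩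
    · exact hv.elim
    · exact hv.elim
    all_goals
      obtain ⟨h1, h2, h3⟩ := key i i'
      obtain ⟨h1', h2', -⟩ := key i' i
      simp only [position] at h
      rcases h3 with rfl | h3 | h3
    rotate_left 3
    · rw [show j = j' from Fin.ext (by omega)]
    all_goals omega

theorem position_next (hp : 0 < p) (ha : ∀ i, 0 < a i) {u : OtimesVertex a} (hu : IsOuter u) :
    position a (next hp ha u) = (position a u + 1) % (otimesLength a + p) := by
  rcases u with _ | ⟨i, j⟩ | ⟨i, j⟩ | ⟨i, j⟩
  · exact hu.elim
  · exact hu.elim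
  · have h1 := prefixSum_even (a := a) i
    have hlt := position_lt ha (isOuter_next hp ha hu)
    suffices h : position a (next hp ha (.leaf i j)) = position a (.leaf i j) + 1 by
      rw [h] at hlt ⊢
      exact (Nat.mod_eq_of_lt hlt).symm
    simp only [next]
    split_ifs <;> simp only [position] <;> omega
  · have h2 := prefixSum_odd (a := a) i
    have hlt := position_lt ha (isOuter_next hp ha hu)
    simp only [next] at hlt ⊢
    split_ifs at hlt ⊢ with h
    · rw [show position a (.path i ⟨j + 1, h⟩) = position a (.path i j) + 1 by
        simp only [position]; omega] at hlt ⊢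
      exact (Nat.mod_eq_of_lt hlt).symm
    · simp only [position] at hlt ⊢
      have hj := j.isLt
      rcases Nat.lt_or_ge (i.val + 1) p with h' | h'
      · have e : 2 * ((i.val + 1) % p) = 2 * i.val + 2 := by rw [Nat.mod_eq_of_lt h']; ring
        have e' := Nat.mod_eq_of_lt h'
        rw [e, e'] at hlt ⊢
        rw [Nat.mod_eq_of_lt (by omega)]
        omega
      · have hi : i.val + 1 = p := by omega
        have h3 : prefixSum a (2 * i + 2) = otimesLength a := by
          rw [← prefixSum_length]
          exact congrArg (prefixSum a) (by omega)
        have e : (i.val + 1) % p = 0 := by rw [hi, Nat.mod_self]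
        rw [show prefixSum a (2 * i + 1) + i + 1 + j + 1 = otimesLength a + p by omega,
          Nat.mod_self, e]
        simp [prefixSum_zero]

theorem eq_next_of_adj (hp : 0 < p) (ha : ∀ i, 0 < a i) {u v : OtimesVertex a} (hu : IsOuter u)
    (hv : IsOuter v) (h : (otimesGraph a).Adj u v) : v = next hp ha u ∨ u = next hp ha v := by
  have lp (i j i' m) (h : (otimesGraph a).Adj (.leaf i j) (.path i' m)) :
      OtimesVertex.path i' m = next hp ha (.leaf i j) ∨
        OtimesVertex.leaf i j = next hp ha (.path i' m) := by
    simp only [otimesGraph, SimpleGraph.fromRel_adj, otimesRel, or_false] at h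
    rcases h with ⟨-, ⟨rfl, hj, hm⟩ | ⟨hi, hj, hm⟩⟩
    · left
      rw [next, dif_neg (by omega), show m = ⟨0, ha _⟩ from Fin.ext hm]
    · right
      obtain rfl : i = ⟨(i' + 1) % p, Nat.mod_lt _ hp⟩ := Fin.ext hi
      rw [next, dif_neg (by omega), show j = ⟨0, Nat.succ_pos _⟩ from Fin.ext hj]
  have pp (i j i' m) (h : otimesRel a (.path i j) (.path i' m)) :
      OtimesVertex.path i' m = next hp ha (.path i j) := by
    obtain ⟨rfl, h⟩ := h
    rw [next, dif_pos (by omega)]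
    simp only [h]
  rcases u with _ | ⟨i, j⟩ | ⟨i, j⟩ | ⟨i, j⟩
  · exact hu.elim
  · exact hu.elim
  · rcases v with _ | ⟨i', j'⟩ | ⟨i', j'⟩ | ⟨i', j'⟩
    · exact hv.elim
    · exact hv.elim
    · exact absurd h not_adj_leaf_leaf
    · exact lp _ _ _ _ h
  · rcases v with _ | ⟨i', j'⟩ | ⟨i', j'⟩ | ⟨i', j'⟩
    · exact hv.elim
    · exact hv.elim
    · exact (lp _ _ _ _ h.symm).symm
    · exact h.2.imp (pp _ _ _ _) (pp _ _ _ _)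

/-- Only consecutive leaves `w_j`, `w_{j+1}` of a gadget fail to be adjacent, and `v_{j+1}` misses
exactly these two. -/
theorem link_next (hp : 0 < p) (ha : ∀ i, 0 < a i) {u : OtimesVertex a} (hu : IsOuter u) :
    (otimesGraph a).Adj u (next hp ha u) ∨ ∃ v, (otimesGraph a).Adj .c v ∧
      ¬ (otimesGraph a).Adj v u ∧ ¬ (otimesGraph a).Adj v (next hp ha u) ∧
      ∀ y, IsOuter y → y ≠ u → y ≠ next hp ha u → (otimesGraph a).Adj v y := by
  rcases u with _ | ⟨i, j⟩ | ⟨i, j⟩ | ⟨i, j⟩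
  · exact hu.elim
  · exact hu.elim
  · simp only [next]
    split_ifs with h
    · right
      refine ⟨.clique i ⟨j, h⟩, adj_clique_c.symm, ?_, ?_, ?_⟩
      · rw [adj_clique_leaf ha, index_clique, index_leaf]
        simp
      · rw [adj_clique_leaf ha, index_clique, index_leaf]
        simp only
        omega
      · rintro (_ | ⟨i', j'⟩ | ⟨i', j'⟩ | ⟨i', j'⟩) hy h1 h2
        · exact hy.elim
        · exact hy.elim
        · have h1 := mt (leaf_index_inj ha) h1
          have h2 := mt (leaf_index_inj ha) h2
          rw [index_leaf, index_leaf] at h1 h2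
          rw [adj_clique_leaf ha, index_clique, index_leaf]
          simp only at h2 ⊢
          omega
        · exact adj_clique_path
    · left
      refine ⟨by simp, Or.inl (Or.inl ⟨rfl, ?_, rfl⟩)⟩
      omega
  · left
    simp only [next]
    split_ifs with h
    · rw [adj_path_path ha, index_path, index_path]
      exact Or.inl (by simp only; omega)
    · refine ⟨by simp, Or.inr (Or.inr ⟨rfl, rfl, ?_⟩)⟩
      omega

theorem not_isCircularArcGraph (hp : 0 < p) (ha : ∀ i, 0 < a i)
    (h11 : List.ofFn a ≠ [1, 1]) (h12 : List.ofFn a ≠ [1, 2]) :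
    ¬ IsCircularArcGraph (otimesGraph a) := by
  intro hG
  let i₀ : Fin p := ⟨0, hp⟩
  let e (t : ℕ) : OtimesVertex a := (next hp ha)^[t] (.leaf i₀ 0)
  have e_succ (t : ℕ) : e (t + 1) = next hp ha (e t) := Function.iterate_succ_apply' _ _ _
  have e_outer (t : ℕ) : IsOuter (e t) := by
    induction t with
    | zero => trivial
    | succ t ih => rw [e_succ]; exact isOuter_next hp ha ih
  have e_pos (t : ℕ) : position a (e t) = t % (otimesLength a + p) := by
    induction t with
    | zero => simp [e, position, i₀, prefixSum_zero]
    | succ t ih => rw [e_succ, position_next hp ha (e_outer t), ih, Nat.mod_add_mod]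
  have hinj (t s : ℕ) (hs : 0 < s) (hs' : s < otimesLength a + p) : e t ≠ e (t + s) := by
    intro h
    have h := congrArg (position a) h
    rw [e_pos, e_pos] at h
    have h' := (Nat.modEq_iff_dvd' (Nat.le_add_right t s)).1 h
    rw [Nat.add_sub_cancel_left] at h'
    exact absurd (Nat.le_of_dvd hs h') (by omega)
  have hfar (t s : ℕ) (hs : 2 ≤ s) (hs' : s + 2 ≤ otimesLength a + p) :
      ¬ (otimesGraph a).Adj (e t) (e (t + s)) := by
    intro h
    rcases eq_next_of_adj hp ha (e_outer _) (e_outer _) h with h | h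
    · rw [← e_succ] at h
      refine hinj (t + 1) (s - 1) (by omega) (by omega) ?_
      rw [← h, show t + 1 + (s - 1) = t + s by omega]
    · rw [← e_succ] at h
      exact hinj t (s + 1) (by omega) (by omega) h
  -- For `p ≥ 2` the length is at least 6. For `p = 1` and `a₀ = 1`, the excluded sequences force
  -- `a₁ ≥ 3`.
  have hshape : 5 ≤ otimesLength a + p ∨ (4 ≤ otimesLength a + p ∧ 2 ≤ a (evenIdx i₀)) := by
    have h1 := prefixSum_even (a := a) i₀
    have h2 := prefixSum_odd (a := a) i₀
    have h3 : prefixSum a (2 * i₀) = 0 := prefixSum_zero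
    have h4 := ha (evenIdx i₀)
    have h5 := ha (oddIdx i₀)
    rcases Nat.lt_or_ge 1 p with h | h
    · have h6 := prefixSum_lt ha (show 2 * i₀.val + 2 < 2 * p by simp only [i₀]; omega) le_rfl
      rw [prefixSum_length] at h6
      omega
    · obtain rfl : p = 1 := by omega
      have h6 : prefixSum a (2 * i₀ + 2) = otimesLength a := prefixSum_length
      by_cases ha0 : a (evenIdx i₀) = 1
      · have h7 : List.ofFn a = [a (evenIdx i₀), a (oddIdx i₀)] := rfl
        rw [h7, ha0] at h11 h12
        have h8 : a (oddIdx i₀) ≠ 1 := fun h => h11 (by rw [h])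
        have h9 : a (oddIdx i₀) ≠ 2 := fun h => h12 (by rw [h])
        omega
      · omega
  obtain ⟨σ, hσ⟩ := hG.exists_bipartition (c := .c) (n := otimesLength a + p) (by omega) e
    (fun t h => by have := e_outer t; rw [h] at this; exact this)
    (fun t h => by
      have := e_outer t
      rcases he : e t with _ | ⟨i, j⟩ | ⟨i, j⟩ | ⟨i, j⟩ <;> rw [he] at this h
      · exact this
      · exact this
      · exact not_adj_leaf_c h.symm
      · exact not_adj_path_c h.symm)
    (fun t => position_inj (e_outer _) (e_outer _) (by rw [e_pos, e_pos, Nat.add_mod_right]))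
    hinj
    (fun t => by
      rw [e_succ]
      exact (link_next hp ha (e_outer t)).imp_right fun ⟨v, h1, h2, h3, h4⟩ =>
        ⟨v, h1, h2, h3, fun s => h4 _ (e_outer s)⟩)
    hfar
  rcases hshape with hlen | ⟨hlen, ha2⟩
  -- The odd cycle 0, 2, 4, 1, 3 of non-adjacent pairs.
  · have h02 := hσ 0 2 (by omega) (by omega) (hfar 0 2 (by omega) (by omega))
    have h24 := hσ 2 2 (by omega) (by omega) (hfar 2 2 (by omega) (by omega))
    have h13 := hσ 1 2 (by omega) (by omega) (hfar 1 2 (by omega) (by omega))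
    have h03 := hσ 0 3 (by omega) (by omega) (hfar 0 3 (by omega) (by omega))
    have h14 := hσ 1 3 (by omega) (by omega) (hfar 1 3 (by omega) (by omega))
    simp only [Nat.reduceAdd, Nat.zero_add] at *
    tauto
  -- The leaves `w_0`, `w_1`, `w_2` of the first gadget form a triangle of non-adjacent pairs.
  · have e1 : e 1 = .leaf i₀ ⟨1, by omega⟩ := by
      rw [e_succ]
      exact dif_pos (ha _)
    have e2 : e 2 = .leaf i₀ ⟨2, by omega⟩ := by
      rw [e_succ, e1]
      exact dif_pos (by simp only; omega)
    have h01 := hσ 0 1 (by omega) (by omega) (by rw [e1]; exact not_adj_leaf_leaf)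
    have h12' := hσ 1 1 (by omega) (by omega) (by rw [e1, e2]; exact not_adj_leaf_leaf)
    have h02 := hσ 0 2 (by omega) (by omega) (hfar 0 2 (by omega) (by omega))
    simp only [Nat.reduceAdd, Nat.zero_add] at *
    tauto

end Otimes

theorem proposition1 (p : ℕ) (hp : 0 < p) (a : Fin (2 * p) → ℕ) (ha : ∀ i, 0 < a i)
    (h11 : List.ofFn a ≠ [1, 1]) (h12 : List.ofFn a ≠ [1, 2]) :
    IsChordalGraph (otimesGraph a) ∧
    ¬ IsCircularArcGraph (otimesGraph a) ∧
    ∀ x : OtimesVertex a,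
      IsHellyCircularArcGraph ((otimesGraph a).induce {x}ᶜ) ∧
      IsHellyCircularArcModel ((otimesGraph a).induce {x}ᶜ) (4 * (otimesLength a : ℝ))
        (fun u => otimesArc a x u.val) :=
  ⟨Otimes.isChordalGraph ha, Otimes.not_isCircularArcGraph hp ha h11 h12, fun x =>
    ⟨Otimes.isHellyCircularArcGraph ha hp x, Otimes.isHellyCircularArcModel ha hp x⟩⟩
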